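/- **Setting.** Let $n\ge 1$, let $\mu$ be Lebesgue measure on $\mathbb R^n$, $\mathfrak L_n$ the class of Lebesgue measurable sets of finite measure, $d_\mu(A,B)=\mu(A\Delta B)$, $\operatorname{ci}(A)$ the closure of the interior of $A$, and $\mathfrak J_n$ the class of bounded sets $A$ with $A=\operatorname{ci}(A)$ and $\mu(\partial A)=0$ (including $\emptyset$). **Distance average.** Let $d_S(p,A)=d(p,\partial A)$ for $p\in A$ and $-d(p,\partial A)$ for $p\notin A$. In an average of $A\ne\emptyset$ with $\emptyset$ put $d_S(p,\emptyset)=-\|p-q_A\|$, where $q_A\in A$ is a chosen point maximizing $d_S(\cdot,A)$ on $A$. Let $f_{A,B,x}=x\,d_S(\cdot,A)+(1-x)\,d_S(\cdot,B)$, $D_x(A,B)=\{f_{A,B,x}\ge 0\}$ (with $D_x(\emptyset,\emptyset)=\emptyset$), and $h(x)=\mu(D_x(A,B))$. The pair $A,B$ satisfies the zero-measure condition if $\mu(\{f_{A,B,1/2}=0\})=0$. Fix numbers $N>1$ and $\varepsilon>0$. **Measure average** $tA\oplus(1-t)B$, for $t\in[0,1]$ (other $t$ are not needed here). 1. Simple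 average of $B\subset A$: if the zero-measure condition holds it is $\operatorname{ci}(D_{g}(A,B))$, where $g\in[-N,N]$ is any minimizer of $|h(\xi)-(t\mu(A)+(1-t)\mu(B))|$ over $\xi\in[-N,N]$; otherwise it is $\operatorname{ci}(\{p:d(p,B)\le r\}\cap A)$, with any $r\ge 0$ for which $\mu(\{p:d(p,B)\le r\}\cap A)=t\mu(A)+(1-t)\mu(B)$. 2. For $B\subseteq A$ in $\mathfrak J_n$: if $A=B$, the average is $A$. Otherwise it is the union, over the parts $C$ of $A\setminus B$, of the simple averages (with the same $t$) of $\operatorname{ci}(B\cup C)$ and $B$. The parts are the connected components of $A\setminus B$ if there are finitely many; otherwise they are the components of measure $\ge\varepsilon$ and, as one more part, the union of all other components. 3. For any $A,B\in\mathfrak J_n$, put $I=\operatorname{ci}(A\cap B)$; then $tA\oplus(1-t)B=\big(tA\oplus(1-t)I\big)\cup\big((1-t)B\oplus tI\big)$. **Scheme of degree $m\ge1$.** From $\{F_i^k\}_{i\in\mathbb Z}$ define $F^{k+1,0}_{2i}=F_i^k$ and $F^{k+1,0}_{2i+1}=\frac12F_i^k\oplus\frac12F_{i+1}^k$; then $F_i^{k+1,j}=\frac12F_i^{k+1,j-1}\oplus\frac12F_{i+1}^{k+1,j-1}$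 for $1\le j\le m-1$; and $F_i^{k+1}=F^{k+1,m-1}_{i-\lfloor (m-1)/2\rfloor}$. For $i2^{-k}\le x\le(i+1)2^{-k}$ let $$F_k(x)=\lambda F_i^k\oplus(1-\lambda)F_{i+1}^k,\qquad \lambda=(i+1)-x2^k .$$ **Theorem.** For every $m\ge 1$ there is a constant $C_m>0$, depending only on $m$, such that the following holds for all $n\ge1$ and all admissible choices ($N$, $\varepsilon$, the points $q_A$) above. Let $G:\mathbb R\to\mathfrak L_n$ be Lipschitz continuous with constant $L\ge 0$, that is, $d_\mu(G(x),G(y))\le L|x-y|$ for all $x,y\in\mathbb R$. Let $h>0$, $\delta\in[0,h)$, and suppose that $F_i^0=G(\delta+ih)\in\mathfrak J_n$ for all $i\in\mathbb Z$. Then (a) $d_\mu\big(G(x),F_k(\tfrac{x-\delta}{h})\big)\le C_mLh$ for all $k\ge0$ and $x\in\mathbb R$; (b) $F_k$ converges uniformly on $\mathbb R$ with respect to $d_\mu$ to a function $F^\infty:\mathbb R\to\mathfrak L_n$, and every such limit satisfies $\sup_{x\in\mathbb R}d_\mu\big(F^\infty(\tfrac{x-\delta}{h}),G(x)\big)\le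 C_mLh$. -/

import Mathlib

noncomputable section

namespace SetSpline

open Set Filter Topology MeasureTheory
open scoped ENNReal

/-- The Euclidean space `ℝⁿ`; `volume` on it is the `n`-dimensional Lebesgue measure. -/
abbrev Space (n : ℕ) : Type := EuclideanSpace ℝ (Fin n)

variable {n : ℕ}

/-- `d_μ(A, B) = μ(A Δ B)`, kept in `[0, ∞]`, so that a finite bound also says that it is finite. -/
def symmDist (A B : Set (Space n)) : ℝ≥0∞ := volume (symmDiff A B)

/-- The class `𝔏ₙ`: Lebesgue measurable sets of finite measure. -/
structure IsFiniteLebesgue (A : Set (Space n)) : Prop where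
  measurable : NullMeasurableSet A volume
  volume_lt_top : volume A < ∞

/-- Closure of the interior. -/
def ci (A : Set (Space n)) : Set (Space n) := closure (interior A)

/-- The class `𝔍ₙ`: regular compact (bounded, equal to the closure of the interior) Jordan
measurable (null boundary) sets. The empty set belongs to it. -/
structure IsRegularJordan (A : Set (Space n)) : Prop where
  bounded : Bornology.IsBounded A
  ci_eq : ci A = A
  volume_frontier : volume (frontier A) = 0

open Classical in
/-- Signed distance from the point `p` to the set `A`: the distance to the boundary of `A`,
taken with the sign `+` on `A` and `-` outside of `A`. -/
def signedDist (p : Space n) (A : Set (Space n)) : ℝ :=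
  if p ∈ A then Metric.infDist p (frontier A) else -Metric.infDist p (frontier A)

/-- The choices that the construction of the measure average leaves free. -/
structure Choices (n : ℕ) where
  /-- the number `N > 1` that bounds the parameters of the distance averages -/
  bound : ℝ
  one_lt_bound : 1 < bound
  /-- the threshold `ε > 0` below which components are joined, if there are infinitely many -/
  threshold : ℝ
  threshold_pos : 0 < threshold
  /-- a point of the set at which the signed distance is maximal -/
  center : Set (Space n) → Space n
  center_mem : ∀ A : Set (Space n), IsRegularJordan A → A.Nonempty → center A ∈ A
  center_max : ∀ A : Set (Space n), IsRegularJordan A → A.Nonempty →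
    ∀ a ∈ A, signedDist a A ≤ signedDist (center A) A

/-- Admissible choices exist. -/
theorem nonempty_choices (n : ℕ) : Nonempty (Choices n) := by
  classical
  have key : ∀ A : Set (Space n), ∃ q : Space n, IsRegularJordan A → A.Nonempty →
      q ∈ A ∧ ∀ a ∈ A, signedDist a A ≤ signedDist q A := by
    intro A
    by_cases h : IsRegularJordan A ∧ A.Nonempty
    · obtain ⟨hA, hne⟩ := h
      have hcl : IsClosed A := by
        rw [← hA.ci_eq]
        exact isClosed_closure
      have hK : IsCompact A := Metric.isCompact_of_isClosed_isBounded hcl hA.bounded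
      obtain ⟨q, hq, hmax⟩ := hK.exists_isMaxOn hne
        (Metric.continuous_infDist_pt (frontier A)).continuousOn
      refine ⟨q, fun _ _ => ⟨hq, fun a ha => ?_⟩⟩
      simpa [signedDist, ha, hq] using hmax ha
    · exact ⟨0, fun h1 h2 => absurd ⟨h1, h2⟩ h⟩
  choose q hq using key
  exact ⟨⟨2, one_lt_two, 1, one_pos, q, fun A h1 h2 => (hq A h1 h2).1,
    fun A h1 h2 => (hq A h1 h2).2⟩⟩

open Classical in
/-- The signed distance to `S` as used in an average of `S` with the set `T`: for `S = ∅` it is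
minus the distance to the chosen center of `T`. -/
def signedDistWith (c : Choices n) (T S : Set (Space n)) (p : Space n) : ℝ :=
  if S = ∅ then -dist p (c.center T) else signedDist p S

/-- The function `f_{A,B,x}(p) = x d_S(p, A) + (1 - x) d_S(p, B)`. -/
def level (c : Choices n) (A B : Set (Space n)) (x : ℝ) (p : Space n) : ℝ :=
  x * signedDistWith c B A p + (1 - x) * signedDistWith c A B p

open Classical in
/-- The distance average of `A` and `B` with parameter `x`; that of two empty sets is empty. -/
def distAverage (c : Choices n) (x : ℝ) (A B : Set (Space n)) : Set (Space n) :=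
  if A = ∅ ∧ B = ∅ then ∅ else {p | 0 ≤ level c A B x p}

/-- The zero-measure condition: the zero set of `f_{A,B,1/2}` is a null set. -/
def ZeroMeasureCondition (c : Choices n) (A B : Set (Space n)) : Prop :=
  volume {p | level c A B (1 / 2) p = 0} = 0

/-- The average `t μ(A) + (1 - t) μ(B)` of the measures. -/
def targetMeasure (t : ℝ) (A B : Set (Space n)) : ℝ :=
  t * (volume A).toReal + (1 - t) * (volume B).toReal

/-- The deviation `|h(x) - (t μ(A) + (1 - t) μ(B))|`, where `h(x)` is the measure of the distance
average with parameter `x`. -/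
def deviation (c : Choices n) (t : ℝ) (A B : Set (Space n)) (x : ℝ) : ℝ :=
  |(volume (distAverage c x A B)).toReal - targetMeasure t A B|

/-- `g(t)`: some minimizer of the deviation over `[-N, N]`. All minimizers lead to the same measure
average. -/
def reparam (c : Choices n) (t : ℝ) (A B : Set (Space n)) : ℝ :=
  Classical.epsilon fun x : ℝ => x ∈ Icc (-c.bound) c.bound ∧
    ∀ ξ ∈ Icc (-c.bound) c.bound, deviation c t A B x ≤ deviation c t A B ξ

open Classical in
/-- The `r`-offset of `B`, as used in an average of `B` with `A`. As for signed distances, the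
distance to `B = ∅` is understood as the distance to the center of `A` (a pair with `B = ∅ ≠ A`
satisfies the zero-measure condition, so that offsets of the empty set play no role). -/
def offset (c : Choices n) (A B : Set (Space n)) (r : ℝ) : Set (Space n) :=
  if B = ∅ then Metric.closedBall (c.center A) r else Metric.cthickening r B

/-- Some radius `r ≥ 0` for which the part of `A` in the `r`-offset of `B` has the averaged measure.
All such radii lead to the same measure average. -/
def offsetRadius (c : Choices n) (t : ℝ) (A B : Set (Space n)) : ℝ :=
  Classical.epsilon fun r : ℝ => 0 ≤ r ∧
    (volume (offset c A B r ∩ A)).toReal = targetMeasure t A B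

open Classical in
/-- The measure average `t A ⊕ (1 - t) B` of simply different sets `B ⊂ A`: a reparametrized
distance average, or, if the zero-measure condition fails and `t ∈ [0, 1]`, the part of `A` in an
offset of `B`. -/
def simpleAverage (c : Choices n) (t : ℝ) (A B : Set (Space n)) : Set (Space n) :=
  if ZeroMeasureCondition c A B ∨ t ∉ Icc (0 : ℝ) 1 then
    ci (distAverage c (reparam c t A B) A B)
  else ci (offset c A B (offsetRadius c t A B) ∩ A)

/-- The connected components of a set `D`. -/
def components (D : Set (Space n)) : Set (Set (Space n)) :=
  {C | ∃ p ∈ D, C = connectedComponentIn D p}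

open Classical in
/-- The parts of `A \ B` that are averaged separately: the connected components, if there are
finitely many of them; otherwise the components of measure at least `ε`, and the union of all other
components as one further part. -/
def parts (c : Choices n) (A B : Set (Space n)) : Set (Set (Space n)) :=
  if (components (A \ B)).Finite then components (A \ B)
  else insert (⋃₀ {C ∈ components (A \ B) | volume C < ENNReal.ofReal c.threshold})
    {C ∈ components (A \ B) | ENNReal.ofReal c.threshold ≤ volume C}

/-- `R_{C,t} = t (B ∪ C) ⊕ (1 - t) B` for a part `C` of `A \ B`. If `A \ B` has finitely many
components, then `B ∪ C` is regular compact and `ci` changes nothing; if there are infinitely many,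
`ci` changes at most a null set, and makes `B ∪ C` regular compact. -/
def partAverage (c : Choices n) (t : ℝ) (B C : Set (Space n)) : Set (Space n) :=
  simpleAverage c t (ci (B ∪ C)) B

open Classical in
/-- The measure average `t A ⊕ (1 - t) B` of nested sets `B ⊆ A`. -/
def nestedAverage (c : Choices n) (t : ℝ) (A B : Set (Space n)) : Set (Space n) :=
  if A = B then A
  else if 0 ≤ t then ⋃ C ∈ parts c A B, partAverage c t B C
  else ci (⋂ C ∈ parts c A B, partAverage c t B C)

open Classical in
/-- The measure average `t A ⊕ (1 - t) B` for `t ≥ 0`, merged from the nested averages of `A` and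
of `B` with `ci (A ∩ B)`. -/
def averageOfNonneg (c : Choices n) (t : ℝ) (A B : Set (Space n)) : Set (Space n) :=
  if t ≤ 1 then
    nestedAverage c t A (ci (A ∩ B)) ∪ nestedAverage c (1 - t) B (ci (A ∩ B))
  else ci (nestedAverage c t A (ci (A ∩ B)) \ (A ∩ B)) ∪ nestedAverage c (1 - t) B (ci (A ∩ B))

open Classical in
/-- The measure average `t A ⊕ (1 - t) B` of arbitrary sets `A`, `B` in `𝔍ₙ`, for real `t`; the case
`t < 0` is reduced to `1 - t > 1` by the symmetry `t A ⊕ (1 - t) B = (1 - t) B ⊕ t A`. -/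
def measureAverage (c : Choices n) (t : ℝ) (A B : Set (Space n)) : Set (Space n) :=
  if 0 ≤ t then averageOfNonneg c t A B else averageOfNonneg c (1 - t) B A

/-- First half of a refinement step: `F_{2i} ↦ F_i`, `F_{2i+1} ↦ ½ F_i ⊕ ½ F_{i+1}`
(`i / 2` is rounded down). -/
def doubleStep (c : Choices n) (F : ℤ → Set (Space n)) : ℤ → Set (Space n) := fun i =>
  if i % 2 = 0 then F (i / 2) else measureAverage c (1 / 2) (F (i / 2)) (F (i / 2 + 1))

/-- Averaging of consecutive sets. -/
def averageStep (c : Choices n) (F : ℤ → Set (Space n)) : ℤ → Set (Space n) := fun i =>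
  measureAverage c (1 / 2) (F i) (F (i + 1))

/-- The refinement step of the spline subdivision scheme of degree `m ≥ 1`: one doubling step,
`m - 1` averaging steps, and the index shift by `⌊(m - 1) / 2⌋`. -/
def refine (c : Choices n) (m : ℕ) (F : ℤ → Set (Space n)) : ℤ → Set (Space n) := fun i =>
  (averageStep c)^[m - 1] (doubleStep c F) (i - (((m - 1) / 2 : ℕ) : ℤ))

/-- The sets `F_i^k` at level `k`, obtained from the initial sets `F_i^0 = F i`. -/
def levelSets (c : Choices n) (m : ℕ) (F : ℤ → Set (Space n)) (k : ℕ) : ℤ → Set (Space n) :=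
  (refine c m)^[k] F

/-- The piecewise interpolant `F_k(x) = λ F_i^k ⊕ (1 - λ) F_{i+1}^k`, `λ = (i + 1) - x 2^k`, on
`i 2^{-k} ≤ x < (i + 1) 2^{-k}`. -/
def interpolant (c : Choices n) (m : ℕ) (F : ℤ → Set (Space n)) (k : ℕ) (x : ℝ) : Set (Space n) :=
  measureAverage c ((⌊x * 2 ^ k⌋ + 1 : ℝ) - x * 2 ^ k)
    (levelSets c m F k ⌊x * 2 ^ k⌋) (levelSets c m F k (⌊x * 2 ^ k⌋ + 1))

/-- The values of `Φ∞` are in `𝔏ₙ`, and `Φ k → Φ∞` uniformly on `ℝ` with respect to `d_μ`. -/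
def IsUniformLimit (Φ : ℕ → ℝ → Set (Space n)) (Φlim : ℝ → Set (Space n)) : Prop :=
  (∀ x, IsFiniteLebesgue (Φlim x)) ∧
    Tendsto (fun k => ⨆ x : ℝ, symmDist (Φ k x) (Φlim x)) atTop (𝓝 0)

end SetSpline

end

noncomputable section

namespace SetSpline

open Set Filter Topology MeasureTheory
open scoped ENNReal

variable {n : ℕ}

/-! The scheme uses only a metric property of the average: `tA ⊕ (1-t)B` stays in `𝔍ₙ`, lies within
`(1-t) d(A,B)` of `A` and within `t d(A,B)` of `B` (`symmDist_measureAverage_left`,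
`symmDist_measureAverage_right`). If consecutive sets are at distance at most `D`, doubling
therefore halves this bound, averaging of neighbours preserves it, and one whole refinement moves a
set by at most a multiple of `m D`. At level `k` the bound has become `2^{-k} D`, so the
displacements form a geometric series. The sets over a fixed point converge at a uniform rate and
stay within `O(m D)` of the initial data; with `D = L h` this is the theorem.

The metric property follows from `IsNestedAverage`: between `B ⊆ A` the average is squeezed, and its
measure is exactly `t μ(A) + (1-t) μ(B)`. For general `A`, `B` the two halves over `I = ci (A ∩ B)`
give the estimate by counting measures (`symmDist_union_le`). For nested sets, the averages over the
parts of `A \ B` overlap outside `B` only in null sets, so that their measures add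
(`isNestedAverage_nestedAverage`).

There remains the simple average, where the prescribed measure must actually be attained. This is
the intermediate value theorem, and the measure depends continuously on the parameter because the
relevant level sets are null. They are porous outside the boundary: walking towards the nearest
boundary point changes the larger weighted distance faster than the smaller one can compensate
(`volume_levelSet_sub_eq_zero_of_lt`). Only equal weights, at parameter `1/2`, escape this argument,
and they are covered by the zero-measure condition. -/

/-! ### Null level sets of distance functions -/

/-- A set that is uniformly porous at all of its points is a null set. -/
theorem volume_eq_zero_of_porous {Z : Set (Space n)} {c : ℝ} (hc : 0 < c)
    (h : ∀ p ∈ Z, ∃ r > 0, ∀ s, 0 < s → s < r →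
      ∃ q, dist p q ≤ s ∧ Z ∩ Metric.closedBall q (c * s) = ∅) :
    volume Z = 0 := by
  -- Lebesgue density along balls that need not be centred at the point: the hole of radius `c s`
  -- has its centre within `s = (1/c)(c s)` of `p`. Its density is zero, whereas at almost every
  -- point of `Z` it would tend to one.
  have key := IsUnifLocDoublingMeasure.ae_tendsto_measure_inter_div
    (volume : Measure (Space n)) Z (1 / c)
  have hZ : ∀ᵐ x ∂(volume.restrict Z), x ∉ Z := by
    filter_upwards [key] with p hp hpZ
    obtain ⟨r, hr, hs⟩ := h p hpZ
    have hs' : ∀ s : ℝ, ∃ q, 0 < s → s < r →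
        dist p q ≤ s ∧ Z ∩ Metric.closedBall q (c * s) = ∅ := by
      intro s
      by_cases h1 : 0 < s ∧ s < r
      · obtain ⟨q, hq⟩ := hs s h1.1 h1.2
        exact ⟨q, fun _ _ => hq⟩
      · exact ⟨p, fun h2 h3 => absurd ⟨h2, h3⟩ h1⟩
    choose w hw using hs'
    have hev : ∀ᶠ s : ℝ in 𝓝[>] 0, 0 < s ∧ s < r := Ioo_mem_nhdsGT hr
    have hδ : Tendsto (fun s : ℝ => c * s) (𝓝[>] 0) (𝓝[>] 0) := by
      refine tendsto_nhdsWithin_iff.2 ⟨?_, ?_⟩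
      · have : Tendsto (fun s : ℝ => c * s) (𝓝 0) (𝓝 (c * 0)) :=
          (continuous_const.mul continuous_id).tendsto 0
        rw [mul_zero] at this
        exact this.mono_left nhdsWithin_le_nhds
      · filter_upwards [hev] with s hs
        exact mul_pos hc hs.1
    have hlim := hp w (fun s => c * s) hδ (by
      filter_upwards [hev] with s hs
      rw [Metric.mem_closedBall]
      have := (hw s hs.1 hs.2).1
      field_simp
      exact this)
    have hzero : Tendsto (fun s : ℝ => volume (Z ∩ Metric.closedBall (w s) (c * s)) /
        volume (Metric.closedBall (w s) (c * s))) (𝓝[>] 0) (𝓝 0) := by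
      refine tendsto_const_nhds.congr' ?_
      filter_upwards [hev] with s hs
      rw [(hw s hs.1 hs.2).2]
      simp
    exact zero_ne_one (tendsto_nhds_unique hzero hlim)
  have := (ae_iff.1 hZ)
  simp only [not_not, ofPred_mem_eq] at this
  rwa [Measure.restrict_apply_self] at this

/-- Moving a distance `s` from `p` towards its nearest point in `K` lowers the first term by `α s`,
while the second changes by at most `β s`. The net drop `(α - β) s` survives in a ball of radius
proportional to `s`, since the function is `(α + β)`-Lipschitz. The constant below makes the ball
consume only half of the drop. -/
theorem volume_levelSet_sub_eq_zero_of_lt {K M : Set (Space n)} (hK : IsClosed K)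
    (hKne : K.Nonempty) {α β γ : ℝ} (hβ : 0 ≤ β) (hαβ : β < α) :
    volume ({p | α * Metric.infDist p K - β * Metric.infDist p M = γ} \ K) = 0 := by
  have hsum : 0 < α + β := by linarith
  refine volume_eq_zero_of_porous (c := (α - β) / (2 * (α + β)))
    (div_pos (by linarith) (by linarith)) ?_
  rintro p ⟨hp, hpK⟩
  obtain ⟨a, haK, ha⟩ := hK.exists_infDist_eq_dist hKne p
  have hρ : 0 < dist p a := by
    rw [dist_pos]
    rintro rfl
    exact hpK haK
  refine ⟨dist p a, hρ, fun s hs hsr => ?_⟩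
  refine ⟨AffineMap.lineMap p a (s / dist p a), ?_, ?_⟩
  · rw [dist_left_lineMap, Real.norm_of_nonneg (by positivity)]
    field_simp
    exact le_rfl
  · set q : Space n := AffineMap.lineMap p a (s / dist p a) with hq
    have hqp : dist p q = s := by
      rw [hq, dist_left_lineMap, Real.norm_of_nonneg (by positivity)]
      field_simp
    have hqa : dist q a = dist p a - s := by
      have h1 : s / dist p a < 1 := (div_lt_one hρ).2 hsr
      rw [hq, dist_lineMap_right, Real.norm_of_nonneg (by linarith)]
      field_simp
    rw [eq_empty_iff_forall_notMem]
    rintro z ⟨⟨hz, -⟩, hzq⟩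
    rw [Metric.mem_closedBall] at hzq
    have e1 : Metric.infDist z K ≤ dist p a - s + dist z q := by
      have := Metric.infDist_le_dist_of_mem (x := z) haK
      linarith [dist_triangle z q a]
    have e2 : Metric.infDist p M ≤ Metric.infDist z M + (s + dist z q) := by
      have := Metric.infDist_le_infDist_add_dist (s := M) (x := p) (y := z)
      linarith [dist_triangle p q z, dist_comm q z]
    have e3 : (α + β) * dist z q ≤ (α - β) * s / 2 := by
      calc (α + β) * dist z q ≤ (α + β) * ((α - β) / (2 * (α + β)) * s) := by gcongr
        _ = (α - β) * s / 2 := by field_simp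
    have hp' : α * Metric.infDist p K - β * Metric.infDist p M = γ := hp
    have hz' : α * Metric.infDist z K - β * Metric.infDist z M = γ := hz
    rw [ha] at hp'
    have e4 := mul_le_mul_of_nonneg_left e1 (by linarith : (0 : ℝ) ≤ α)
    have e5 := mul_le_mul_of_nonneg_left e2 hβ
    nlinarith [mul_pos (sub_pos.2 hαβ) hs]

/-- The set with the larger weight takes the role of `K` in the porosity estimate; being null
itself, it may be added back. -/
theorem volume_infDist_eq_infDist_eq_zero {K M : Set (Space n)} (hK : IsClosed K)
    (hKne : K.Nonempty) (hK0 : volume K = 0) (hM : IsClosed M) (hMne : M.Nonempty)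
    (hM0 : volume M = 0) {α β : ℝ} (hα : 0 ≤ α) (hβ : 0 ≤ β) (hαβ : α ≠ β) :
    volume {p : Space n | α * Metric.infDist p K = β * Metric.infDist p M} = 0 := by
  rcases lt_or_gt_of_ne hαβ with h | h
  · refine measure_mono_null (t := ({p | β * Metric.infDist p M - α * Metric.infDist p K = 0} \ M)
      ∪ M) ?_ (measure_union_null (volume_levelSet_sub_eq_zero_of_lt hM hMne hα h) hM0)
    intro p hp
    by_cases hpM : p ∈ M
    · exact Or.inr hpM
    · exact Or.inl ⟨by simp only [mem_ofPred_eq] at hp ⊢; linarith, hpM⟩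
  · refine measure_mono_null (t := ({p | α * Metric.infDist p K - β * Metric.infDist p M = 0} \ K)
      ∪ K) ?_ (measure_union_null (volume_levelSet_sub_eq_zero_of_lt hK hKne hβ h) hK0)
    intro p hp
    by_cases hpK : p ∈ K
    · exact Or.inr hpK
    · exact Or.inl ⟨by simp only [mem_ofPred_eq] at hp ⊢; linarith, hpK⟩

theorem volume_infDist_eq_zero {K : Set (Space n)} (hK : IsClosed K) (hKne : K.Nonempty)
    {r : ℝ} (hr : 0 < r) : volume {p : Space n | Metric.infDist p K = r} = 0 := by
  -- With `β = 0` the second distance is irrelevant, so `M = ∅` will do.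
  refine measure_mono_null ?_ (volume_levelSet_sub_eq_zero_of_lt (M := ∅) (γ := r) hK hKne
    le_rfl one_pos)
  intro p hp
  refine ⟨by simpa using hp, fun hpK => ?_⟩
  have hp' : Metric.infDist p K = r := hp
  rw [Metric.infDist_zero_of_mem hpK] at hp'
  exact hr.ne hp'

/-! ### Regular Jordan sets and nested averages -/

namespace IsRegularJordan

variable {A B : Set (Space n)}

theorem isClosed (hA : IsRegularJordan A) : IsClosed A := by
  rw [← hA.ci_eq]
  exact isClosed_closure

theorem isCompact (hA : IsRegularJordan A) : IsCompact A :=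
  Metric.isCompact_of_isClosed_isBounded hA.isClosed hA.bounded

theorem volume_ne_top (hA : IsRegularJordan A) : volume A ≠ ∞ :=
  hA.isCompact.measure_lt_top.ne

/-- The open set `interior A \ B` is null, hence empty; then take closures. Inclusions in `𝔍ₙ` need
only be checked up to null sets. -/
theorem subset_of_volume_diff_eq_zero (hA : IsRegularJordan A) (hB : IsRegularJordan B)
    (h : volume (A \ B) = 0) : A ⊆ B := by
  have h1 : volume (interior A \ B) = 0 :=
    measure_mono_null (sdiff_subset_sdiff_left interior_subset) h
  have h2 : interior A \ B = ∅ :=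
    (isOpen_interior.sdiff hB.isClosed).measure_eq_zero_iff volume |>.1 h1
  rw [← hA.ci_eq]
  exact closure_minimal (sdiff_eq_empty.1 h2) hB.isClosed

theorem empty : IsRegularJordan (∅ : Set (Space n)) :=
  ⟨Bornology.isBounded_empty, by simp [ci], by simp⟩

theorem union (hA : IsRegularJordan A) (hB : IsRegularJordan B) : IsRegularJordan (A ∪ B) where
  bounded := hA.bounded.union hB.bounded
  ci_eq := by
    refine Subset.antisymm
      (closure_minimal interior_subset (hA.isClosed.union hB.isClosed)) ?_
    refine union_subset ?_ ?_
    · conv_lhs => rw [← hA.ci_eq]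
      exact closure_mono (interior_mono subset_union_left)
    · conv_lhs => rw [← hB.ci_eq]
      exact closure_mono (interior_mono subset_union_right)
  volume_frontier := by
    refine measure_mono_null ?_ (measure_union_null hA.volume_frontier hB.volume_frontier)
    refine (frontier_union_subset A B).trans ?_
    exact union_subset_union inter_subset_left inter_subset_right

end IsRegularJordan

theorem ci_subset {D : Set (Space n)} (hD : IsClosed D) : ci D ⊆ D :=
  closure_minimal interior_subset hD

theorem isRegularJordan_ci {D : Set (Space n)} (hb : Bornology.IsBounded (ci D))
    (h0 : volume (frontier (ci D)) = 0) : IsRegularJordan (ci D) :=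
  ⟨hb, closure_interior_idem, h0⟩

theorem frontier_ci_subset (D : Set (Space n)) : frontier (ci D) ⊆ frontier D :=
  frontier_closure_subset.trans frontier_interior_subset

theorem volume_diff_ci {D : Set (Space n)} (h0 : volume (frontier D) = 0) :
    volume (D \ ci D) = 0 :=
  measure_mono_null (sdiff_subset_sdiff subset_closure subset_closure) h0

/-- The defining properties of an average `t A ⊕ (1 - t) B` of nested sets `B ⊆ A`. -/
structure IsNestedAverage (t : ℝ) (A B E : Set (Space n)) : Prop where
  regular : IsRegularJordan E
  left : B ⊆ E
  right : E ⊆ A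
  measure : volume.real E = t * volume.real A + (1 - t) * volume.real B

/-- As the boundary of `D` is null, `ci` removes only a null set; regularity then upgrades the
inclusions from almost everywhere to everywhere. -/
theorem isNestedAverage_ci {t : ℝ} {A B D : Set (Space n)} (hA : IsRegularJordan A)
    (hB : IsRegularJordan B) (hD : IsCompact D) (h0 : volume (frontier D) = 0)
    (hBD : volume (B \ D) = 0) (hDA : volume (D \ A) = 0)
    (hm : volume.real D = t * volume.real A + (1 - t) * volume.real B) :
    IsNestedAverage t A B (ci D) := by
  have hsub := ci_subset hD.isClosed
  have hE : IsRegularJordan (ci D) :=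
    isRegularJordan_ci (hD.isBounded.subset hsub) (measure_mono_null (frontier_ci_subset D) h0)
  refine ⟨hE, hB.subset_of_volume_diff_eq_zero hE ?_, hE.subset_of_volume_diff_eq_zero hA ?_, ?_⟩
  · refine measure_mono_null ?_ (measure_union_null hBD (volume_diff_ci h0))
    intro p hp
    by_cases h : p ∈ D
    · exact Or.inr ⟨h, hp.2⟩
    · exact Or.inl ⟨hp.1, h⟩
  · exact measure_mono_null (sdiff_subset_sdiff_left hsub) hDA
  · rw [← hm]
    refine congrArg ENNReal.toReal (measure_eq_measure_of_null_sdiff hsub (volume_diff_ci h0))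

/-- Off the zero set at `x` the sign of `f · p` is locally constant, so the indicators converge
almost everywhere, dominated by that of `S`. -/
theorem continuousWithinAt_measure_nonneg {α : Type*} [MeasurableSpace α] {μ : Measure α}
    {f : ℝ → α → ℝ} {T : Set ℝ} {x : ℝ} {S : Set α} (hx : x ∈ T) (hS : MeasurableSet S)
    (hSfin : μ S ≠ ∞) (hf : ∀ x, Measurable (f x))
    (hcont : ∀ p, ContinuousWithinAt (fun x => f x p) T x)
    (hsub : ∀ y ∈ T, {p | 0 ≤ f y p} ⊆ S) (h0 : μ {p | f x p = 0} = 0) :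
    ContinuousWithinAt (fun y => μ.real {p | 0 ≤ f y p}) T x := by
  have hm : ∀ y, MeasurableSet {p | 0 ≤ f y p} := fun y => measurableSet_le measurable_const (hf y)
  have := tendsto_measure_of_ae_tendsto_indicator (μ := μ) (𝓝[T] x) (hm x) hm hS hSfin
    (eventually_mem_nhdsWithin.mono hsub) (by
      have h1 : ∀ᵐ p ∂μ, f x p ≠ 0 := by
        rw [ae_iff]
        simpa using h0
      filter_upwards [h1] with p hp
      rcases lt_or_gt_of_ne hp with h | h
      · filter_upwards [(hcont p).eventually (eventually_lt_nhds h)] with y hy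
        exact iff_of_false (not_le.2 hy) (not_le.2 h)
      · filter_upwards [(hcont p).eventually (eventually_gt_nhds h)] with y hy
        exact iff_of_true hy.le h.le)
  refine (ENNReal.tendsto_toReal ?_).comp this
  exact ((measure_mono (hsub x hx)).trans_lt hSfin.lt_top).ne

theorem infDist_frontier_of_mem {A : Set (Space n)} {p : Space n} (hp : p ∈ A) (hA : A ≠ univ) :
    Metric.infDist p (frontier A) = Metric.infDist p Aᶜ := by
  obtain ⟨y, hy, hy'⟩ := exists_mem_frontier_infDist_compl_eq_dist hp hA
  refine le_antisymm (hy' ▸ Metric.infDist_le_dist_of_mem hy) ?_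
  rw [← Metric.infDist_closure (s := Aᶜ)]
  refine Metric.infDist_le_infDist_of_subset ?_ ⟨y, hy⟩
  rw [← frontier_compl]
  exact frontier_subset_closure

theorem abs_signedDist (p : Space n) (A : Set (Space n)) :
    |signedDist p A| = Metric.infDist p (frontier A) := by
  unfold signedDist
  split_ifs
  · exact abs_of_nonneg Metric.infDist_nonneg
  · rw [abs_neg, abs_of_nonneg Metric.infDist_nonneg]

/-- Handles parameters outside `[0,1]`, where monotonicity yields the inclusion opposite to the
desired one. -/
theorem volume_diff_eq_zero_of_subset {D E : Set (Space n)} (hD : IsCompact D) (hE : IsCompact E)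
    (h : D ⊆ E ∨ E ⊆ D) (hm : volume.real D ≤ volume.real E) : volume (D \ E) = 0 := by
  rcases h with h | h
  · simp [sdiff_eq_empty.2 h]
  · rw [measure_sdiff h hE.measurableSet.nullMeasurableSet hE.measure_lt_top.ne]
    rw [measureReal_def, measureReal_def,
      ENNReal.toReal_le_toReal hD.measure_lt_top.ne hE.measure_lt_top.ne] at hm
    exact tsub_eq_zero_of_le hm

theorem convexCombination_mem_Icc {a b t : ℝ} (hab : b ≤ a) (ht : t ∈ Icc (0 : ℝ) 1) :
    t * a + (1 - t) * b ∈ Icc b a := by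
  obtain ⟨h0, h1⟩ := ht
  constructor <;> nlinarith

/-! ### Signed distances and their combinations -/

section SignedDist

variable [Nontrivial (Space n)] {A S : Set (Space n)}

theorem frontier_nonempty_of_isCompact (hA : IsCompact A) (hne : A.Nonempty) :
    (frontier A).Nonempty :=
  nonempty_frontier_iff.2 ⟨hne, hA.ne_univ⟩

/-- One of the two terms always vanishes. In this form continuity and monotonicity in the set are
immediate. Nontriviality of the space keeps the complement of a compact set nonempty. -/
theorem signedDist_eq (hA : IsCompact A) (hne : A.Nonempty) (p : Space n) :
    signedDist p A = Metric.infDist p Aᶜ - Metric.infDist p A := by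
  unfold signedDist
  split_ifs with hp
  · rw [infDist_frontier_of_mem hp hA.ne_univ, Metric.infDist_zero_of_mem hp, sub_zero]
  · have hp' : p ∈ Aᶜ := hp
    have : Aᶜ ≠ univ := by simpa using hne.ne_empty
    rw [← frontier_compl, infDist_frontier_of_mem hp' this, Metric.infDist_zero_of_mem hp',
      compl_compl, zero_sub]

theorem continuous_signedDist (hA : IsCompact A) (hne : A.Nonempty) :
    Continuous fun p => signedDist p A := by
  simp_rw [signedDist_eq hA hne]
  exact (Metric.continuous_infDist_pt _).sub (Metric.continuous_infDist_pt _)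

theorem signedDist_mono (hA : IsCompact A) (hS : IsCompact S) (hne : S.Nonempty) (hSA : S ⊆ A)
    (p : Space n) : signedDist p S ≤ signedDist p A := by
  rw [signedDist_eq hA (hne.mono hSA), signedDist_eq hS hne]
  have h1 := Metric.infDist_le_infDist_of_subset (x := p) hSA hne
  have h2 := Metric.infDist_le_infDist_of_subset (x := p) (compl_subset_compl.2 hSA)
    (nonempty_compl.2 hA.ne_univ)
  linarith

theorem signedDist_nonneg_iff (hA : IsCompact A) (hne : A.Nonempty) {p : Space n} :
    0 ≤ signedDist p A ↔ p ∈ A := by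
  constructor
  · intro h
    by_contra hp
    have hp' : p ∈ Aᶜ := hp
    rw [signedDist_eq hA hne, Metric.infDist_zero_of_mem hp'] at h
    have := (hA.isClosed.notMem_iff_infDist_pos hne).1 hp
    linarith
  · intro hp
    rw [signedDist, if_pos hp]
    exact Metric.infDist_nonneg

/-- Far out, every signed distance is `-‖p‖` up to a bounded error. As the weights sum to one, so is
every combination, even one with a negative weight. -/
theorem abs_signedDist_add_norm_le (hA : IsCompact A) (hne : A.Nonempty) {R : ℝ}
    (hR : A ⊆ Metric.closedBall 0 R) {p : Space n} (hp : R < ‖p‖) :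
    |signedDist p A + ‖p‖| ≤ R := by
  have hpA : p ∈ Aᶜ := fun h => by
    have := hR h
    rw [mem_closedBall_zero_iff] at this
    linarith
  rw [signedDist_eq hA hne, Metric.infDist_zero_of_mem hpA]
  obtain ⟨a, ha, ha'⟩ := hA.exists_infDist_eq_dist hne p
  rw [ha', dist_eq_norm]
  have h1 := hR ha
  rw [mem_closedBall_zero_iff] at h1
  rw [abs_le]
  constructor
  · linarith [norm_sub_le p a]
  · linarith [norm_sub_norm_le p a]

/-- The combination `x d_S(·, A) + (1 - x) d_S(·, S)` of the signed distances to two nonempty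
sets. -/
def blend (A S : Set (Space n)) (x : ℝ) (p : Space n) : ℝ :=
  x * signedDist p A + (1 - x) * signedDist p S

theorem blend_nonneg_subset_closedBall (hA : IsCompact A) (hS : IsCompact S) (hne : S.Nonempty)
    (hSA : S ⊆ A) {R N x : ℝ} (hR0 : 0 ≤ R) (hR : A ⊆ Metric.closedBall 0 R) (hN : 1 ≤ N)
    (hx : x ∈ Icc (-N) N) :
    {p | 0 ≤ blend A S x p} ⊆ Metric.closedBall 0 (3 * N * R) := by
  intro p hp
  rw [mem_closedBall_zero_iff]
  by_contra! hlt
  have hRp : R < ‖p‖ := by nlinarith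
  have hp' : 0 ≤ blend A S x p := hp
  have h1 := abs_signedDist_add_norm_le hA (hne.mono hSA) hR hRp
  have h2 := abs_signedDist_add_norm_le hS hne (hSA.trans hR) hRp
  have e1 : x * (signedDist p A + ‖p‖) ≤ N * R := by
    refine (le_abs_self _).trans ?_
    rw [abs_mul]
    exact mul_le_mul (abs_le.2 hx) h1 (abs_nonneg _) (by linarith)
  -- `|1 - x| ≤ 1 + N ≤ 2 N`; the two errors together account for the radius `3 N R`.
  have e2 : (1 - x) * (signedDist p S + ‖p‖) ≤ (2 * N) * R := by
    refine (le_abs_self _).trans ?_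
    rw [abs_mul]
    refine mul_le_mul (abs_le.2 ⟨?_, ?_⟩) h2 (abs_nonneg _) (by linarith)
    · linarith [hx.2]
    · linarith [hx.1]
  unfold blend at hp'
  linarith

theorem continuous_blend (hA : IsCompact A) (hS : IsCompact S) (hne : S.Nonempty)
    (hSA : S ⊆ A) (x : ℝ) : Continuous (blend A S x) :=
  (continuous_const.mul (continuous_signedDist hA (hne.mono hSA))).add
    (continuous_const.mul (continuous_signedDist hS hne))

theorem isCompact_blend_nonneg (hA : IsCompact A) (hS : IsCompact S) (hne : S.Nonempty)
    (hSA : S ⊆ A) (x : ℝ) : IsCompact {p | 0 ≤ blend A S x p} := by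
  obtain ⟨R, hR⟩ := hA.isBounded.subset_closedBall 0
  have hR' : A ⊆ Metric.closedBall 0 (max R 0) :=
    hR.trans (Metric.closedBall_subset_closedBall (le_max_left _ _))
  have := blend_nonneg_subset_closedBall (x := x) (N := max 1 |x|) hA hS hne hSA
    (le_max_right _ _) hR' (le_max_left _ _) (abs_le.1 (le_max_right _ _))
  exact Metric.isCompact_of_isClosed_isBounded
    (isClosed_le continuous_const (continuous_blend hA hS hne hSA x))
    (Metric.isBounded_closedBall.subset this)

theorem blend_mono (hA : IsCompact A) (hS : IsCompact S) (hne : S.Nonempty) (hSA : S ⊆ A)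
    {x y : ℝ} (hxy : x ≤ y) (p : Space n) : blend A S x p ≤ blend A S y p := by
  have := signedDist_mono hA hS hne hSA p
  unfold blend
  nlinarith

theorem blend_zero_nonneg (hS : IsCompact S) (hne : S.Nonempty) :
    {p | 0 ≤ blend A S 0 p} = S := by
  ext p
  simp [blend, signedDist_nonneg_iff hS hne]

theorem blend_one_nonneg (hA : IsCompact A) (hne : A.Nonempty) :
    {p | 0 ≤ blend A S 1 p} = A := by
  ext p
  simp [blend, signedDist_nonneg_iff hA hne]

/-- On the zero set the distances to the two boundaries have weights `|x|` and `|1 - x|`, and these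
agree only at `x = 1/2`. -/
theorem volume_blend_eq_zero (hA : IsCompact A) (hS : IsCompact S) (hne : S.Nonempty)
    (hSA : S ⊆ A) (hA0 : volume (frontier A) = 0) (hS0 : volume (frontier S) = 0)
    (hhalf : volume {p | blend A S (1 / 2) p = 0} = 0) (x : ℝ) :
    volume {p | blend A S x p = 0} = 0 := by
  by_cases hx : x = 1 / 2
  · rwa [hx]
  · refine measure_mono_null ?_ (volume_infDist_eq_infDist_eq_zero (α := |x|) (β := |1 - x|)
      isClosed_frontier (frontier_nonempty_of_isCompact hA (hne.mono hSA)) hA0 isClosed_frontier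
      (frontier_nonempty_of_isCompact hS hne) hS0 (abs_nonneg _) (abs_nonneg _) ?_)
    · intro p hp
      have hp' : x * signedDist p A + (1 - x) * signedDist p S = 0 := hp
      change |x| * _ = |1 - x| * _
      rw [← abs_signedDist, ← abs_signedDist, ← abs_mul, ← abs_mul,
        eq_neg_of_add_eq_zero_left hp', abs_neg]
    · intro h
      rcases abs_eq_abs.1 h with h | h
      · exact hx (by linarith)
      · linarith

theorem volume_frontier_blend_nonneg (hA : IsCompact A) (hS : IsCompact S) (hne : S.Nonempty)
    (hSA : S ⊆ A) {x : ℝ} (h : volume {p | blend A S x p = 0} = 0) :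
    volume (frontier {p | 0 ≤ blend A S x p}) = 0 := by
  refine measure_mono_null ?_ h
  refine (frontier_le_subset_eq continuous_const (continuous_blend hA hS hne hSA x)).trans ?_
  intro p hp
  exact Eq.symm hp

/-- Intermediate values between the parameters `0` and `1`, where the sets are `S` and `A`. -/
theorem exists_blend_measure_eq (hA : IsCompact A) (hS : IsCompact S) (hne : S.Nonempty)
    (hSA : S ⊆ A) (hnull : ∀ x, volume {p | blend A S x p = 0} = 0) {τ : ℝ}
    (hτ : τ ∈ Icc (volume.real S) (volume.real A)) :
    ∃ x ∈ Icc (0 : ℝ) 1, volume.real {p | 0 ≤ blend A S x p} = τ := by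
  have hcont : ContinuousOn (fun x => volume.real {p | 0 ≤ blend A S x p}) (Icc 0 1) := by
    intro x hx
    refine continuousWithinAt_measure_nonneg hx hA.measurableSet hA.measure_lt_top.ne
      (fun y => (continuous_blend hA hS hne hSA y).measurable) (fun p => ?_) (fun y hy => ?_)
      (hnull x)
    · unfold blend
      exact (by fun_prop : Continuous _).continuousWithinAt
    · conv_rhs => rw [← blend_one_nonneg (S := S) hA (hne.mono hSA)]
      exact fun p hp => le_trans hp (blend_mono hA hS hne hSA hy.2 p)
  have := intermediate_value_Icc zero_le_one hcont
  rw [blend_zero_nonneg hS hne, blend_one_nonneg hA (hne.mono hSA)] at this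
  exact this hτ

end SignedDist

/-! ### Simple averages -/

open Classical in
/-- The set that stands for `B` in an average with `A`: the center of `A` if `B` is empty. -/
def core (c : Choices n) (A B : Set (Space n)) : Set (Space n) :=
  if B = ∅ then {c.center A} else B

section Core

variable {A B : Set (Space n)} (c : Choices n)

theorem isCompact_core (hB : IsRegularJordan B) : IsCompact (core c A B) := by
  unfold core
  split_ifs
  · exact isCompact_singleton
  · exact hB.isCompact

theorem core_nonempty : (core c A B).Nonempty := by
  unfold core
  split_ifs with h
  · exact singleton_nonempty _
  · exact nonempty_iff_ne_empty.2 h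

theorem subset_core : B ⊆ core c A B := by
  unfold core
  split_ifs with h
  · simp [h]
  · exact Subset.rfl

theorem core_subset (hA : IsRegularJordan A) (hne : A.Nonempty) (hBA : B ⊆ A) :
    core c A B ⊆ A := by
  unfold core
  split_ifs
  · exact singleton_subset_iff.2 (c.center_mem A hA hne)
  · exact hBA

theorem offset_eq {r : ℝ} (hr : 0 ≤ r) :
    offset c A B r = {p | Metric.infDist p (core c A B) ≤ r} := by
  unfold offset core
  split_ifs with h
  · ext p
    simp
  · have hB : B.Nonempty := nonempty_iff_ne_empty.2 h
    ext p
    rw [Metric.cthickening_eq_preimage_infEDist, mem_preimage, mem_Iic, mem_ofPred_eq,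
      Metric.infDist, ENNReal.le_ofReal_iff_toReal_le (Metric.infEDist_ne_top hB) hr]

variable [Nontrivial (Space n)]

theorem volume_core : volume (core c A B) = volume B := by
  unfold core
  split_ifs with h
  · simp [h]
  · rfl

theorem volume_frontier_core (hB : IsRegularJordan B) :
    volume (frontier (core c A B)) = 0 := by
  unfold core
  split_ifs with h
  · refine measure_mono_null (isClosed_singleton.frontier_subset) ?_
    simp
  · exact hB.volume_frontier

/-- The complement of a point is dense, so the signed distance to a singleton is minus the distance
to the point. The case `B = ∅` thus becomes an instance of the general one. -/
theorem signedDistWith_eq (p : Space n) :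
    signedDistWith c A B p = signedDist p (core c A B) := by
  unfold signedDistWith core
  split_ifs with h
  · rw [signedDist_eq isCompact_singleton (singleton_nonempty _), Metric.infDist_singleton,
      ← Metric.infDist_closure, (dense_compl_singleton (c.center A)).closure_eq,
      Metric.infDist_zero_of_mem (mem_univ p), zero_sub]
  · rfl

theorem level_eq (hne : A.Nonempty) (x : ℝ) : level c A B x = blend A (core c A B) x := by
  ext p
  rw [level, blend, signedDistWith_eq c (A := A) (B := B), signedDistWith, if_neg hne.ne_empty]

theorem distAverage_eq (hne : A.Nonempty) (x : ℝ) :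
    distAverage c x A B = {p | 0 ≤ blend A (core c A B) x p} := by
  rw [distAverage, if_neg fun h => hne.ne_empty h.1, level_eq c hne]

/-- The deviation vanishes at some `ξ ∈ [0,1]`, which lies in `[-N,N]` because `N > 1`; hence every
minimizer attains the prescribed measure exactly. -/
theorem isNestedAverage_distAverage (hA : IsRegularJordan A) (hB : IsRegularJordan B)
    (hne : A.Nonempty) (hBA : B ⊆ A) (hz : ZeroMeasureCondition c A B) {t : ℝ}
    (ht : t ∈ Icc (0 : ℝ) 1) :
    IsNestedAverage t A B (ci (distAverage c (reparam c t A B) A B)) := by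
  have hS := isCompact_core (A := A) c hB
  have hSne := core_nonempty (A := A) (B := B) c
  have hSA := core_subset c hA hne hBA
  have hSvol : volume.real (core c A B) = volume.real B :=
    congrArg ENNReal.toReal (volume_core c)
  have hnull : ∀ x, volume {p | blend A (core c A B) x p = 0} = 0 := by
    refine volume_blend_eq_zero hA.isCompact hS hSne hSA hA.volume_frontier
      (volume_frontier_core c hB) ?_
    rw [← level_eq c hne]
    exact hz
  have hmono : volume.real B ≤ volume.real A := measureReal_mono hBA hA.volume_ne_top
  have hτ : t * volume.real A + (1 - t) * volume.real B ∈
      Icc (volume.real B) (volume.real A) := convexCombination_mem_Icc hmono ht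
  obtain ⟨ξ, hξ, hξτ⟩ := exists_blend_measure_eq hA.isCompact hS hSne hSA hnull
    (by rwa [hSvol])
  have hdev : ∀ x, deviation c t A B x = |volume.real {p | 0 ≤ blend A (core c A B) x p} -
      (t * volume.real A + (1 - t) * volume.real B)| := fun x => by
    rw [deviation, distAverage_eq c hne]
    rfl
  have hdξ : deviation c t A B ξ = 0 := by
    rw [hdev, hξτ, sub_self, abs_zero]
  have hξN : ξ ∈ Icc (-c.bound) c.bound := by
    have := c.one_lt_bound
    constructor <;> linarith [hξ.1, hξ.2]
  have hg : reparam c t A B ∈ Icc (-c.bound) c.bound ∧ ∀ ξ ∈ Icc (-c.bound) c.bound,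
      deviation c t A B (reparam c t A B) ≤ deviation c t A B ξ :=
    Classical.epsilon_spec (p := fun x : ℝ => x ∈ Icc (-c.bound) c.bound ∧
      ∀ ξ ∈ Icc (-c.bound) c.bound, deviation c t A B x ≤ deviation c t A B ξ)
      ⟨ξ, hξN, fun η _ => by rw [hdξ]; exact abs_nonneg _⟩
  generalize reparam c t A B = g at hg
  have hm := hg.2 ξ hξN
  rw [hdξ, hdev, abs_nonpos_iff, sub_eq_zero] at hm
  rw [distAverage_eq c hne]
  have hD := isCompact_blend_nonneg hA.isCompact hS hSne hSA g
  refine isNestedAverage_ci hA hB hD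
    (volume_frontier_blend_nonneg hA.isCompact hS hSne hSA (hnull g)) ?_ ?_ hm
  · refine measure_mono_null (sdiff_subset_sdiff_left (subset_core (A := A) c)) ?_
    refine volume_diff_eq_zero_of_subset hS hD ?_ (by rw [hSvol, hm]; exact hτ.1)
    have hS0 := blend_zero_nonneg (A := A) hS hSne
    -- The minimizer may be negative. Then `D_g` lies in the core, but its measure is no smaller, so
    -- they differ by a null set.
    rcases le_total 0 g with h | h
    · left
      intro p hp
      rw [← hS0] at hp
      exact le_trans hp (blend_mono hA.isCompact hS hSne hSA h p)
    · right
      intro p hp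
      rw [← hS0]
      exact le_trans hp (blend_mono hA.isCompact hS hSne hSA h p)
  · refine volume_diff_eq_zero_of_subset hD hA.isCompact ?_ (by rw [hm]; exact hτ.2)
    have hA1 := blend_one_nonneg (S := core c A B) hA.isCompact hne
    rcases le_total g 1 with h | h
    · left
      intro p hp
      rw [← hA1]
      exact le_trans hp (blend_mono hA.isCompact hS hSne hSA h p)
    · right
      intro p hp
      rw [← hA1] at hp
      exact le_trans hp (blend_mono hA.isCompact hS hSne hSA h p)

theorem exists_offset_measure_eq (hA : IsRegularJordan A) (hB : IsRegularJordan B)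
    (hne : A.Nonempty) (hBA : B ⊆ A) {τ : ℝ} (hτ : τ ∈ Icc (volume.real B) (volume.real A)) :
    ∃ r, 0 ≤ r ∧ volume.real (offset c A B r ∩ A) = τ := by
  classical
  have hS := isCompact_core (A := A) c hB
  have hSne := core_nonempty (A := A) (B := B) c
  have hSA := core_subset c hA hne hBA
  set S := core c A B with hSdef
  -- The value `1` on `S` keeps the zero set null at `r = 0`, where otherwise it would be `S`
  -- itself; the sets `{0 ≤ f r}` are unchanged for `r ≥ 0`.
  let f : ℝ → Space n → ℝ := fun r p => if p ∈ S then 1 else r - Metric.infDist p S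
  have hf : ∀ r, 0 ≤ r → {p | 0 ≤ f r p} = {p | Metric.infDist p S ≤ r} := by
    intro r hr
    ext p
    by_cases hp : p ∈ S
    · simp [f, hp, Metric.infDist_zero_of_mem hp, hr]
    · simp [f, hp]
  have hfm : ∀ r, Measurable (f r) := fun r =>
    Measurable.ite hS.measurableSet measurable_const
      (measurable_const.sub (Metric.continuous_infDist_pt S).measurable)
  obtain ⟨R, hR0, hR⟩ : ∃ R, 0 ≤ R ∧ ∀ p ∈ A, Metric.infDist p S ≤ R := by
    obtain ⟨R, hR⟩ := (hA.isCompact.image (Metric.continuous_infDist_pt S)).bddAbove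
    exact ⟨max R 0, le_max_right _ _, fun p hp =>
      (hR (mem_image_of_mem _ hp)).trans (le_max_left _ _)⟩
  have hcont : ContinuousOn (fun r => (volume.restrict A).real {p | 0 ≤ f r p}) (Icc 0 R) := by
    intro r hr
    refine continuousWithinAt_measure_nonneg hr MeasurableSet.univ ?_ hfm (fun p => ?_)
      (fun _ _ => subset_univ _) ?_
    · rw [Measure.restrict_apply_univ]
      exact hA.volume_ne_top
    · by_cases hp : p ∈ S
      · simpa [f, hp] using continuousWithinAt_const
      · simp only [f, hp, if_false]
        exact (continuous_id.sub continuous_const).continuousWithinAt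
    · refine le_antisymm ((Measure.restrict_apply_le _ _).trans ?_) bot_le
      rcases hr.1.eq_or_lt with h | h
      · refine (measure_mono_null (t := ∅) ?_ measure_empty).le
        intro p hp
        by_cases hpS : p ∈ S
        · simp [f, hpS] at hp
        · have hpos := (hS.isClosed.notMem_iff_infDist_pos hSne).1 hpS
          simp only [f, hpS, if_false, mem_ofPred_eq, ← h] at hp
          linarith
      · refine (measure_mono_null ?_ (volume_infDist_eq_zero hS.isClosed hSne h)).le
        intro p hp
        by_cases hpS : p ∈ S
        · simp [f, hpS] at hp
        · simp only [f, hpS, if_false, mem_ofPred_eq] at hp ⊢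
          linarith
  have hval : ∀ r, 0 ≤ r → (volume.restrict A).real {p | 0 ≤ f r p} =
      volume.real (offset c A B r ∩ A) := by
    intro r hr
    rw [offset_eq c hr, ← hSdef, ← hf r hr, measureReal_def, measureReal_def,
      Measure.restrict_apply' hA.isClosed.measurableSet]
  have himg := intermediate_value_Icc hR0 hcont
  have h0 : volume.real (offset c A B 0 ∩ A) = volume.real B := by
    rw [offset_eq c le_rfl, ← hSdef]
    have : {p | Metric.infDist p S ≤ 0} ∩ A = S := by
      ext p
      constructor
      · rintro ⟨hp, -⟩
        exact (hS.isClosed.mem_iff_infDist_zero hSne).2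
          (le_antisymm hp Metric.infDist_nonneg)
      · intro hp
        exact ⟨(Metric.infDist_zero_of_mem hp).le, hSA hp⟩
    rw [this, hSdef]
    exact congrArg ENNReal.toReal (volume_core c)
  have h1 : volume.real (offset c A B R ∩ A) = volume.real A := by
    rw [offset_eq c hR0, ← hSdef, inter_eq_self_of_subset_right (s := {p | Metric.infDist p S ≤ R}) hR]
  simp only [hval 0 le_rfl, hval R hR0, h0, h1] at himg
  obtain ⟨r, hr, hrτ⟩ := himg hτ
  exact ⟨r, hr.1, by rw [← hval r hr.1]; exact hrτ⟩

theorem isNestedAverage_offset (hA : IsRegularJordan A) (hB : IsRegularJordan B)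
    (hne : A.Nonempty) (hBA : B ⊆ A) {t : ℝ} (ht : t ∈ Icc (0 : ℝ) 1) :
    IsNestedAverage t A B (ci (offset c A B (offsetRadius c t A B) ∩ A)) := by
  have hmono : volume.real B ≤ volume.real A := measureReal_mono hBA hA.volume_ne_top
  have hr : 0 ≤ offsetRadius c t A B ∧
      (volume (offset c A B (offsetRadius c t A B) ∩ A)).toReal = targetMeasure t A B :=
    Classical.epsilon_spec (p := fun r : ℝ => 0 ≤ r ∧
      (volume (offset c A B r ∩ A)).toReal = targetMeasure t A B)
      (exists_offset_measure_eq c hA hB hne hBA (convexCombination_mem_Icc hmono ht))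
  generalize offsetRadius c t A B = r at hr
  obtain ⟨hr0, hrm⟩ := hr
  have hS := isCompact_core (A := A) c hB
  have hSne := core_nonempty (A := A) (B := B) c
  have hcl : IsClosed {p | Metric.infDist p (core c A B) ≤ r} :=
    isClosed_le (Metric.continuous_infDist_pt _) continuous_const
  have hsub : B ⊆ {p | Metric.infDist p (core c A B) ≤ r} := fun p hp => by
    rw [mem_ofPred_eq, Metric.infDist_zero_of_mem (subset_core c hp)]
    exact hr0
  have hfr : volume (frontier {p | Metric.infDist p (core c A B) ≤ r}) = 0 := by
    rcases hr0.eq_or_lt with h | h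
    · have : {p | Metric.infDist p (core c A B) ≤ r} = core c A B := by
        ext p
        rw [hS.isClosed.mem_iff_infDist_zero hSne, mem_ofPred_eq, ← h]
        exact ⟨fun hp => le_antisymm hp Metric.infDist_nonneg, fun hp => hp.le⟩
      rw [this]
      exact volume_frontier_core c hB
    · refine measure_mono_null ?_ (volume_infDist_eq_zero hS.isClosed hSne h)
      exact frontier_le_subset_eq (Metric.continuous_infDist_pt _) continuous_const
  rw [offset_eq c hr0] at hrm ⊢
  refine isNestedAverage_ci hA hB (hA.isCompact.inter_left hcl) ?_ ?_ ?_ hrm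
  · refine measure_mono_null (frontier_inter_subset _ _) ?_
    exact measure_union_null (measure_mono_null inter_subset_left hfr)
      (measure_mono_null inter_subset_right hA.volume_frontier)
  · rw [sdiff_eq_empty.2 (subset_inter hsub hBA), measure_empty]
  · rw [sdiff_eq_empty.2 inter_subset_right, measure_empty]

theorem isNestedAverage_simpleAverage (hA : IsRegularJordan A) (hB : IsRegularJordan B)
    (hBA : B ⊆ A) {t : ℝ} (ht : t ∈ Icc (0 : ℝ) 1) :
    IsNestedAverage t A B (simpleAverage c t A B) := by
  rcases A.eq_empty_or_nonempty with rfl | hne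
  · obtain rfl : B = ∅ := subset_empty_iff.1 hBA
    have : simpleAverage c t ∅ ∅ = (∅ : Set (Space n)) := by
      simp [simpleAverage, distAverage, ci]
    rw [this]
    exact ⟨IsRegularJordan.empty, Subset.rfl, Subset.rfl, by simp⟩
  · unfold simpleAverage
    split_ifs with h
    · exact isNestedAverage_distAverage c hA hB hne hBA (h.resolve_right (not_not.2 ht)) ht
    · exact isNestedAverage_offset c hA hB hne hBA ht

end Core

/-! ### Components and parts of `A \ B` -/

/-- A set `C ⊆ D` that contains with each of its points the whole connected component in `D`. -/
structure IsSaturated (D C : Set (Space n)) : Prop where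
  subset : C ⊆ D
  component_subset : ∀ p ∈ C, connectedComponentIn D p ⊆ C

section Parts

variable {A B C D : Set (Space n)}

theorem isSaturated_of_mem_components (hC : C ∈ components D) : IsSaturated D C := by
  obtain ⟨p, -, rfl⟩ := hC
  exact ⟨connectedComponentIn_subset _ _, fun q hq => (connectedComponentIn_eq hq).symm.subset⟩

theorem isSaturated_sUnion {𝒞 : Set (Set (Space n))} (h : ∀ C ∈ 𝒞, IsSaturated D C) :
    IsSaturated D (⋃₀ 𝒞) := by
  refine ⟨sUnion_subset fun C hC => (h C hC).subset, ?_⟩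
  rintro p ⟨C, hC, hp⟩
  exact ((h C hC).component_subset p hp).trans (subset_sUnion_of_mem hC)

theorem IsSaturated.diff (hC : IsSaturated D C) : IsSaturated D (D \ C) := by
  refine ⟨sdiff_subset, fun p hp q hq => ⟨connectedComponentIn_subset _ _ hq, fun hqC => hp.2 ?_⟩⟩
  refine hC.component_subset q hqC ?_
  rw [← connectedComponentIn_eq hq]
  exact mem_connectedComponentIn hp.1

/-- A small ball around a point of `interior A \ B` is connected, hence stays within one component.
-/
theorem IsSaturated.isOpen_inter_interior (hB : IsClosed B) (hC : IsSaturated (A \ B) C) :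
    IsOpen (C ∩ interior A) := by
  rw [Metric.isOpen_iff]
  rintro p ⟨hp, hpA⟩
  have hpB : p ∉ B := (hC.subset hp).2
  obtain ⟨r, hr, hball⟩ := Metric.isOpen_iff.1 (isOpen_interior.sdiff hB) p ⟨hpA, hpB⟩
  refine ⟨r, hr, subset_inter ?_ (hball.trans sdiff_subset)⟩
  have h1 : Metric.ball p r ⊆ A \ B := hball.trans (sdiff_subset_sdiff_left interior_subset)
  exact ((convex_ball p r).isPreconnected.subset_connectedComponentIn
    (Metric.mem_ball_self hr) h1).trans (hC.component_subset p hp)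

theorem IsSaturated.nullMeasurableSet (hA : IsRegularJordan A) (hB : IsRegularJordan B)
    (hC : IsSaturated (A \ B) C) : NullMeasurableSet C := by
  have h1 : volume (C \ interior A) = 0 :=
    measure_mono_null (sdiff_subset_sdiff_left ((hC.subset.trans sdiff_subset).trans
      subset_closure)) hA.volume_frontier
  rw [← inter_union_sdiff C (interior A)]
  exact (hC.isOpen_inter_interior hB.isClosed).measurableSet.nullMeasurableSet.union
    (NullMeasurableSet.of_null h1)

/-- A boundary point outside `∂A` and `∂B` would be interior to `A` and outside `B`. There both `C`
and its complement in `A \ B` are open, so no such point exists. -/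
theorem IsSaturated.volume_frontier_union (hA : IsRegularJordan A) (hB : IsRegularJordan B)
    (hBA : B ⊆ A) (hC : IsSaturated (A \ B) C) : volume (frontier (B ∪ C)) = 0 := by
  refine measure_mono_null ?_ (measure_union_null hA.volume_frontier hB.volume_frontier)
  rintro p ⟨hpc, hpi⟩
  by_contra hcon
  rw [mem_union, not_or] at hcon
  have hpA : p ∈ A :=
    closure_minimal (union_subset hBA (hC.subset.trans sdiff_subset)) hA.isClosed hpc
  have hpiA : p ∈ interior A := by
    by_contra h
    exact hcon.1 ⟨subset_closure hpA, h⟩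
  by_cases hpB : p ∈ B
  · have hpiB : p ∈ interior B := by
      by_contra h
      exact hcon.2 ⟨subset_closure hpB, h⟩
    exact hpi (interior_mono subset_union_left hpiB)
  · by_cases hpC : p ∈ C
    · exact hpi (interior_maximal (inter_subset_left.trans subset_union_right)
        (hC.isOpen_inter_interior hB.isClosed) ⟨hpC, hpiA⟩)
    · obtain ⟨q, hq, hq'⟩ := mem_closure_iff.1 hpc _ (hC.diff.isOpen_inter_interior hB.isClosed)
        ⟨⟨⟨hpA, hpB⟩, hpC⟩, hpiA⟩
      rcases hq' with h | h
      · exact hq.1.1.2 h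
      · exact hq.1.2 h

theorem IsSaturated.isRegularJordan_ci (hA : IsRegularJordan A) (hB : IsRegularJordan B)
    (hBA : B ⊆ A) (hC : IsSaturated (A \ B) C) : IsRegularJordan (ci (B ∪ C)) := by
  refine SetSpline.isRegularJordan_ci (hA.bounded.subset ?_)
    (measure_mono_null (frontier_ci_subset _) (hC.volume_frontier_union hA hB hBA))
  exact closure_minimal (interior_subset.trans
    (union_subset hBA (hC.subset.trans sdiff_subset))) hA.isClosed

theorem IsSaturated.ci_subset (hA : IsRegularJordan A) (hBA : B ⊆ A)
    (hC : IsSaturated (A \ B) C) : ci (B ∪ C) ⊆ A :=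
  closure_minimal (interior_subset.trans
    (union_subset hBA (hC.subset.trans sdiff_subset))) hA.isClosed

theorem IsSaturated.volume_ci_diff (hA : IsRegularJordan A) (hB : IsRegularJordan B)
    (hBA : B ⊆ A) (hC : IsSaturated (A \ B) C) : volume (ci (B ∪ C) \ (B ∪ C)) = 0 :=
  measure_mono_null (sdiff_subset_sdiff (closure_mono interior_subset) interior_subset)
    (hC.volume_frontier_union hA hB hBA)

theorem IsSaturated.volume_ci (hA : IsRegularJordan A) (hB : IsRegularJordan B)
    (hBA : B ⊆ A) (hC : IsSaturated (A \ B) C) :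
    volume.real (ci (B ∪ C)) = volume.real B + volume.real C := by
  have h1 : ci (B ∪ C) =ᵐ[volume] (B ∪ C : Set (Space n)) :=
    (ae_le_set.2 (hC.volume_ci_diff hA hB hBA)).antisymm
      (ae_le_set.2 (volume_diff_ci (hC.volume_frontier_union hA hB hBA)))
  have hdisj : Disjoint B C := disjoint_left.2 fun p hpB hpC => (hC.subset hpC).2 hpB
  have hfin : volume C ≠ ∞ :=
    ((measure_mono (hC.subset.trans sdiff_subset)).trans_lt hA.volume_ne_top.lt_top).ne
  rw [measureReal_congr h1, measureReal_def, measure_union' hdisj hB.isClosed.measurableSet,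
    ENNReal.toReal_add hB.volume_ne_top hfin]
  rfl

variable (c : Choices n)

theorem components_pairwise_disjoint (D : Set (Space n)) :
    (components D).Pairwise Disjoint := by
  rintro _ ⟨p, hp, rfl⟩ _ ⟨q, hq, rfl⟩ hne
  refine disjoint_left.2 fun z hz hz' => hne ?_
  rw [connectedComponentIn_eq hz, connectedComponentIn_eq hz']

theorem sUnion_components (D : Set (Space n)) : ⋃₀ components D = D := by
  refine Subset.antisymm (sUnion_subset fun C hC => (isSaturated_of_mem_components hC).subset) ?_
  exact fun p hp => ⟨_, ⟨p, hp, rfl⟩, mem_connectedComponentIn hp⟩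

theorem isSaturated_of_mem_parts (hC : C ∈ parts c A B) : IsSaturated (A \ B) C := by
  unfold parts at hC
  split_ifs at hC
  · exact isSaturated_of_mem_components hC
  · rcases hC with rfl | hC
    · exact isSaturated_sUnion fun C hC => isSaturated_of_mem_components hC.1
    · exact isSaturated_of_mem_components hC.1

/-- Only finitely many disjoint sets of measure at least `ε` fit into `A`, which has finite measure.
-/
theorem parts_finite (hA : IsRegularJordan A) (hB : IsRegularJordan B) :
    (parts c A B).Finite := by
  unfold parts
  split_ifs with h
  · exact h
  · refine Finite.insert _ ?_
    have := Measure.finite_const_le_meas_of_disjoint_iUnion₀ (volume : Measure (Space n))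
      (ENNReal.ofReal_pos.2 c.threshold_pos)
      (As := fun C : components (A \ B) => (C : Set (Space n)))
      (fun C => (isSaturated_of_mem_components C.2).nullMeasurableSet hA hB)
      (fun C C' hne => (components_pairwise_disjoint (A \ B) C.2 C'.2
        (fun h => hne (Subtype.ext h))).aedisjoint) (by
        refine ((measure_mono (iUnion_subset fun C => ?_)).trans_lt hA.volume_ne_top.lt_top).ne
        exact (isSaturated_of_mem_components C.2).subset.trans sdiff_subset)
    refine (this.image Subtype.val).subset ?_
    rintro C ⟨hC, hCε⟩
    exact ⟨⟨C, hC⟩, hCε, rfl⟩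

theorem parts_pairwise_disjoint : (parts c A B).Pairwise Disjoint := by
  unfold parts
  split_ifs
  · exact components_pairwise_disjoint _
  · refine pairwise_insert_of_symm.2
      ⟨(components_pairwise_disjoint _).mono fun _ h => h.1, fun C hC _ => ?_⟩
    rw [disjoint_sUnion_left]
    rintro C' ⟨hC', hlt⟩
    refine components_pairwise_disjoint _ hC' hC.1 ?_
    rintro rfl
    exact absurd hC.2 (not_le.2 hlt)

theorem sUnion_parts : ⋃₀ parts c A B = A \ B := by
  unfold parts
  split_ifs
  · exact sUnion_components _
  · conv_rhs => rw [← sUnion_components (A \ B)]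
    rw [sUnion_insert, ← sUnion_union]
    congr 1
    ext C
    simp only [mem_union, mem_ofPred_eq, ← and_or_left]
    exact and_iff_left (lt_or_ge _ _)

theorem parts_nonempty (h : (A \ B).Nonempty) : (parts c A B).Nonempty := by
  rw [← sUnion_parts c, nonempty_sUnion] at h
  obtain ⟨C, hC, -⟩ := h
  exact ⟨C, hC⟩

end Parts

/-! ### Averages of nested sets -/

section NestedAverage

variable [Nontrivial (Space n)] {A B : Set (Space n)} (c : Choices n)

/-- Outside `B`, each part `C` contributes measure `t μ(C)`; these contributions add up to `t μ(A \
B)`. -/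
theorem isNestedAverage_nestedAverage (hA : IsRegularJordan A) (hB : IsRegularJordan B)
    (hBA : B ⊆ A) {t : ℝ} (ht : t ∈ Icc (0 : ℝ) 1) :
    IsNestedAverage t A B (nestedAverage c t A B) := by
  unfold nestedAverage
  split_ifs with hAB h0
  · subst hAB
    exact ⟨hA, Subset.rfl, Subset.rfl, by ring⟩
  swap
  · exact absurd ht.1 h0
  have hfin := parts_finite c hA hB
  have hsat : ∀ C ∈ parts c A B, IsSaturated (A \ B) C := fun C hC =>
    isSaturated_of_mem_parts c hC
  have havg : ∀ C ∈ parts c A B, IsNestedAverage t (ci (B ∪ C)) B (partAverage c t B C) :=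
    fun C hC => by
      refine isNestedAverage_simpleAverage c ((hsat C hC).isRegularJordan_ci hA hB hBA) hB ?_ ht
      conv_lhs => rw [← hB.ci_eq]
      exact closure_mono (interior_mono subset_union_left)
  have hne : (parts c A B).Nonempty := parts_nonempty c
    (sdiff_nonempty.2 fun h => hAB (h.antisymm hBA))
  have hE : IsRegularJordan (⋃ C ∈ parts c A B, partAverage c t B C) := by
    have : ∀ 𝒞 ⊆ parts c A B, 𝒞.Finite → IsRegularJordan (⋃ C ∈ 𝒞, partAverage c t B C) := by
      intro 𝒞 hsub h𝒞
      induction 𝒞, h𝒞 using Set.Finite.induction_on with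
      | empty => simpa using IsRegularJordan.empty
      | insert hC _ ih =>
        rw [biUnion_insert]
        exact (havg _ (hsub (mem_insert _ _))).regular.union
          (ih ((subset_insert _ _).trans hsub))
    exact this _ Subset.rfl hfin
  have hBE : B ⊆ ⋃ C ∈ parts c A B, partAverage c t B C := by
    obtain ⟨C, hC⟩ := hne
    exact (havg C hC).left.trans (subset_biUnion_of_mem (u := partAverage c t B) hC)
  refine ⟨hE, hBE, ?_, ?_⟩
  · exact iUnion₂_subset fun C hC => (havg C hC).right.trans ((hsat C hC).ci_subset hA hBA)
  · have hCfin : ∀ C ∈ parts c A B, volume C ≠ ∞ := fun C hC =>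
      ((measure_mono ((hsat C hC).subset.trans sdiff_subset)).trans_lt hA.volume_ne_top.lt_top).ne
    have hpart : ∀ C ∈ parts c A B, volume.real (partAverage c t B C \ B) = t * volume.real C := by
      intro C hC
      rw [measureReal_sdiff (havg C hC).left hB.isClosed.measurableSet
          (havg C hC).regular.volume_ne_top,
        (havg C hC).measure, (hsat C hC).volume_ci hA hB hBA]
      ring
    have hsum : volume.real ((⋃ C ∈ parts c A B, partAverage c t B C) \ B) =
        t * volume.real (A \ B) := by
      have e1 : (⋃ C ∈ parts c A B, partAverage c t B C) \ B =
          ⋃ C ∈ hfin.toFinset, (partAverage c t B C \ B) := by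
        ext p
        simp only [Set.mem_sdiff, mem_iUnion, Finite.mem_toFinset, exists_prop]
        exact ⟨fun ⟨⟨C, hC, hp⟩, hpB⟩ => ⟨C, hC, hp, hpB⟩,
          fun ⟨C, hC, hp, hpB⟩ => ⟨⟨C, hC, hp⟩, hpB⟩⟩
      have e2 : A \ B = ⋃ C ∈ hfin.toFinset, C := by
        rw [← sUnion_parts c, sUnion_eq_biUnion]
        simp
      have h1 : (hfin.toFinset : Set (Set (Space n))).Pairwise
          (Function.onFun (AEDisjoint volume) fun C => partAverage c t B C \ B) := by
        rw [Finite.coe_toFinset]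
        intro C hC C' hC' hne
        -- Distinct parts are disjoint, so a common point outside `B` was added by `ci` to `B ∪ C`
        -- or to `B ∪ C'`.
        refine measure_mono_null ?_ (measure_union_null ((hsat C hC).volume_ci_diff hA hB hBA)
          ((hsat C' hC').volume_ci_diff hA hB hBA))
        rintro p ⟨⟨h1, hpB⟩, h2, -⟩
        by_cases hpC : p ∈ C
        · right
          refine ⟨(havg C' hC').right h2, ?_⟩
          rintro (h | h)
          · exact hpB h
          · exact disjoint_left.1 (parts_pairwise_disjoint c hC hC' hne) hpC h
        · left
          refine ⟨(havg C hC).right h1, ?_⟩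
          rintro (h | h)
          · exact hpB h
          · exact hpC h
      have h2 : (hfin.toFinset : Set (Set (Space n))).Pairwise
          (Function.onFun (AEDisjoint volume) fun C => C) := by
        rw [Finite.coe_toFinset]
        exact fun C hC C' hC' hne => (parts_pairwise_disjoint c hC hC' hne).aedisjoint
      rw [e1, e2, measureReal_biUnion_finset₀ h1
          (fun C hC => ((havg C (hfin.mem_toFinset.1 hC)).regular.isClosed.measurableSet.diff
            hB.isClosed.measurableSet).nullMeasurableSet)
          (fun C hC => ((measure_mono sdiff_subset).trans_lt
            (havg C (hfin.mem_toFinset.1 hC)).regular.volume_ne_top.lt_top).ne),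
        measureReal_biUnion_finset₀ h2
          (fun C hC => (hsat C (hfin.mem_toFinset.1 hC)).nullMeasurableSet hA hB)
          (fun C hC => hCfin C (hfin.mem_toFinset.1 hC)), Finset.mul_sum]
      exact Finset.sum_congr rfl fun C hC => hpart C (hfin.mem_toFinset.1 hC)
    rw [measureReal_sdiff hBE hB.isClosed.measurableSet hE.volume_ne_top,
      measureReal_sdiff hBA hB.isClosed.measurableSet hA.volume_ne_top] at hsum
    linarith

end NestedAverage

/-! ### The distance `d_μ` and the average of arbitrary sets -/

theorem symmDist_comm (A B : Set (Space n)) : symmDist A B = symmDist B A := by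
  rw [symmDist, symmDist, symmDiff_comm]

theorem symmDist_self (A : Set (Space n)) : symmDist A A = 0 := by
  simp [symmDist]

theorem symmDist_triangle (A B C : Set (Space n)) :
    symmDist A C ≤ symmDist A B + symmDist B C :=
  (measure_mono (symmDiff_triangle A B C)).trans (measure_union_le _ _)

theorem IsRegularJordan.isFiniteLebesgue {A : Set (Space n)} (hA : IsRegularJordan A) :
    IsFiniteLebesgue A :=
  ⟨hA.isClosed.measurableSet.nullMeasurableSet, hA.volume_ne_top.lt_top⟩

section Average

variable {A B : Set (Space n)}

theorem volume_frontier_inter (hA : IsRegularJordan A) (hB : IsRegularJordan B) :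
    volume (frontier (A ∩ B)) = 0 := by
  refine measure_mono_null (frontier_inter_subset _ _) ?_
  exact measure_union_null (measure_mono_null inter_subset_left hA.volume_frontier)
    (measure_mono_null inter_subset_right hB.volume_frontier)

theorem IsRegularJordan.ci_inter (hA : IsRegularJordan A) (hB : IsRegularJordan B) :
    IsRegularJordan (ci (A ∩ B)) :=
  isRegularJordan_ci
    (hA.bounded.subset ((ci_subset (hA.isClosed.inter hB.isClosed)).trans inter_subset_left))
    (measure_mono_null (frontier_ci_subset _) (volume_frontier_inter hA hB))

theorem volume_ci_inter (hA : IsRegularJordan A) (hB : IsRegularJordan B) :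
    volume.real (ci (A ∩ B)) = volume.real (A ∩ B) :=
  congrArg ENNReal.toReal (measure_eq_measure_of_null_sdiff
    (ci_subset (hA.isClosed.inter hB.isClosed)) (volume_diff_ci (volume_frontier_inter hA hB)))

theorem symmDist_eq (hA : IsRegularJordan A) (hB : IsRegularJordan B) :
    symmDist A B =
      ENNReal.ofReal (volume.real A + volume.real B - 2 * volume.real (ci (A ∩ B))) := by
  have h1 := measureReal_sdiff_add_inter (μ := volume) (s := A) hB.isClosed.measurableSet
    hA.volume_ne_top
  have h2 := measureReal_sdiff_add_inter (μ := volume) (s := B) hA.isClosed.measurableSet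
    hB.volume_ne_top
  have f1 : volume (A \ B) ≠ ∞ :=
    ((measure_mono sdiff_subset).trans_lt hA.volume_ne_top.lt_top).ne
  have f2 : volume (B \ A) ≠ ∞ :=
    ((measure_mono sdiff_subset).trans_lt hB.volume_ne_top.lt_top).ne
  rw [inter_comm] at h2
  rw [symmDist, measure_symmDiff_eq hA.isClosed.measurableSet.nullMeasurableSet
    hB.isClosed.measurableSet.nullMeasurableSet, ← ENNReal.ofReal_toReal f1,
    ← ENNReal.ofReal_toReal f2, ← ENNReal.ofReal_add ENNReal.toReal_nonneg
    ENNReal.toReal_nonneg, ← measureReal_def, ← measureReal_def, volume_ci_inter hA hB]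
  congr 1
  linarith

/-- With `I = ci (A ∩ B)`, what the union has in excess of `A` lies in `E₂ \ I`, and what it lacks
lies in `A \ E₁`. Their measures are `(1-t) μ(B \ I)` and `(1-t) μ(A \ I)`. -/
theorem symmDist_union_le (hA : IsRegularJordan A) (hB : IsRegularJordan B)
    {t : ℝ} (ht : t ≤ 1) {E₁ E₂ : Set (Space n)} (h₁ : IsNestedAverage t A (ci (A ∩ B)) E₁)
    (h₂ : IsNestedAverage (1 - t) B (ci (A ∩ B)) E₂) :
    symmDist (E₁ ∪ E₂) A ≤ ENNReal.ofReal (1 - t) * symmDist A B := by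
  have hI := hA.ci_inter hB
  have hIA : ci (A ∩ B) ⊆ A :=
    (ci_subset (hA.isClosed.inter hB.isClosed)).trans inter_subset_left
  have hsub : symmDiff (E₁ ∪ E₂) A ⊆ (E₂ \ ci (A ∩ B)) ∪ (A \ E₁) := by
    rintro p (⟨h | h, hpA⟩ | ⟨hpA, h⟩)
    · exact absurd (h₁.right h) hpA
    · exact Or.inl ⟨h, fun hp => hpA (hIA hp)⟩
    · exact Or.inr ⟨hpA, fun hp => h (Or.inl hp)⟩
  have e1 : volume.real (E₂ \ ci (A ∩ B)) =
      (1 - t) * (volume.real B - volume.real (ci (A ∩ B))) := by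
    rw [measureReal_sdiff h₂.left hI.isClosed.measurableSet h₂.regular.volume_ne_top, h₂.measure]
    ring
  have e2 : volume.real (A \ E₁) = (1 - t) * (volume.real A - volume.real (ci (A ∩ B))) := by
    rw [measureReal_sdiff h₁.right h₁.regular.isClosed.measurableSet hA.volume_ne_top, h₁.measure]
    ring
  have f1 : volume (E₂ \ ci (A ∩ B)) ≠ ∞ :=
    ((measure_mono sdiff_subset).trans_lt h₂.regular.volume_ne_top.lt_top).ne
  have f2 : volume (A \ E₁) ≠ ∞ :=
    ((measure_mono sdiff_subset).trans_lt hA.volume_ne_top.lt_top).ne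
  calc symmDist (E₁ ∪ E₂) A ≤ volume (E₂ \ ci (A ∩ B)) + volume (A \ E₁) :=
        (measure_mono hsub).trans (measure_union_le _ _)
    _ = ENNReal.ofReal (1 - t) * symmDist A B := by
        rw [symmDist_eq hA hB, ← ENNReal.ofReal_mul (by linarith), ← ENNReal.ofReal_toReal f1,
          ← ENNReal.ofReal_toReal f2, ← ENNReal.ofReal_add ENNReal.toReal_nonneg
          ENNReal.toReal_nonneg, ← measureReal_def, ← measureReal_def, e1, e2]
        congr 1
        ring

variable [Nontrivial (Space n)] (c : Choices n) {t : ℝ}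

theorem exists_measureAverage_eq_union (hA : IsRegularJordan A) (hB : IsRegularJordan B)
    (ht : t ∈ Icc (0 : ℝ) 1) :
    ∃ E₁ E₂, IsNestedAverage t A (ci (A ∩ B)) E₁ ∧ IsNestedAverage (1 - t) B (ci (A ∩ B)) E₂ ∧
      measureAverage c t A B = E₁ ∪ E₂ := by
  have hI := hA.ci_inter hB
  have hsub := ci_subset (hA.isClosed.inter hB.isClosed)
  refine ⟨_, _, isNestedAverage_nestedAverage c hA hI (hsub.trans inter_subset_left) ht,
    isNestedAverage_nestedAverage c hB hI (hsub.trans inter_subset_right)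
      ⟨sub_nonneg.2 ht.2, sub_le_self _ ht.1⟩, ?_⟩
  rw [measureAverage, if_pos ht.1, averageOfNonneg, if_pos ht.2]

theorem isRegularJordan_measureAverage (hA : IsRegularJordan A) (hB : IsRegularJordan B)
    (ht : t ∈ Icc (0 : ℝ) 1) : IsRegularJordan (measureAverage c t A B) := by
  obtain ⟨E₁, E₂, h₁, h₂, h⟩ := exists_measureAverage_eq_union c hA hB ht
  rw [h]
  exact h₁.regular.union h₂.regular

theorem symmDist_measureAverage_left (hA : IsRegularJordan A) (hB : IsRegularJordan B)
    (ht : t ∈ Icc (0 : ℝ) 1) :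
    symmDist (measureAverage c t A B) A ≤ ENNReal.ofReal (1 - t) * symmDist A B := by
  obtain ⟨E₁, E₂, h₁, h₂, h⟩ := exists_measureAverage_eq_union c hA hB ht
  rw [h]
  exact symmDist_union_le hA hB ht.2 h₁ h₂

theorem symmDist_measureAverage_right (hA : IsRegularJordan A) (hB : IsRegularJordan B)
    (ht : t ∈ Icc (0 : ℝ) 1) :
    symmDist (measureAverage c t A B) B ≤ ENNReal.ofReal t * symmDist A B := by
  obtain ⟨E₁, E₂, h₁, h₂, h⟩ := exists_measureAverage_eq_union c hA hB ht
  rw [h, union_comm, symmDist_comm A B]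
  have h₁' : IsNestedAverage (1 - (1 - t)) A (ci (B ∩ A)) E₁ := by
    rwa [sub_sub_cancel, inter_comm]
  rw [inter_comm] at h₂
  have := symmDist_union_le hB hA (sub_le_self 1 ht.1) h₂ h₁'
  rwa [sub_sub_cancel] at this

end Average

/-- A sequence of sets with `d_μ(A_k, A_{k+1}) ≤ b_k` and `∑ b_k < ∞` has a limit. -/
theorem exists_symmDist_le_tsum {A : ℕ → Set (Space n)} {b : ℕ → ℝ≥0∞}
    (hA : ∀ k, IsFiniteLebesgue (A k)) (hb : ∀ k, symmDist (A k) (A (k + 1)) ≤ b k)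
    (hsum : ∑' k, b k ≠ ∞) :
    ∃ S, IsFiniteLebesgue S ∧ ∀ k, symmDist (A k) S ≤ ∑' j, b (k + j) := by
  -- The limit superior of the sequence. A point whose membership never changes from index `k` on
  -- belongs to `S` exactly if it belongs to `A k`.
  let S : Set (Space n) := ⋂ N : ℕ, ⋃ j : ℕ, A (N + j)
  have hS : ∀ k, symmDist (A k) S ≤ ∑' j, b (k + j) := by
    intro k
    have hsub : symmDiff (A k) S ⊆ ⋃ j, symmDiff (A (k + j)) (A (k + j + 1)) := by
      intro p hp
      by_contra hcon
      rw [mem_iUnion, not_exists] at hcon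
      have hiff : ∀ j, p ∈ A (k + j) ↔ p ∈ A k := by
        intro j
        induction j with
        | zero => rfl
        | succ j ih =>
          rw [← ih, ← add_assoc]
          have := hcon j
          rw [mem_symmDiff] at this
          tauto
      have hpS : p ∈ S ↔ p ∈ A k := by
        simp only [S, mem_iInter, mem_iUnion]
        constructor
        · intro h
          obtain ⟨j, hj⟩ := h k
          exact (hiff j).1 hj
        · intro h N
          refine ⟨k, ?_⟩
          rw [add_comm]
          exact (hiff N).2 h
      rw [mem_symmDiff] at hp
      tauto
    refine (measure_mono hsub).trans ((measure_iUnion_le _).trans ?_)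
    exact ENNReal.tsum_le_tsum fun j => hb (k + j)
  refine ⟨S, ⟨?_, ?_⟩, hS⟩
  · exact NullMeasurableSet.iInter fun N => NullMeasurableSet.iUnion fun j => (hA _).measurable
  · have hsub : S ⊆ A 0 ∪ symmDiff (A 0) S := fun p hp => by
      by_cases h : p ∈ A 0
      · exact Or.inl h
      · exact Or.inr (Or.inr ⟨hp, h⟩)
    have h0 := hS 0
    simp only [zero_add] at h0
    exact ((measure_mono hsub).trans (measure_union_le _ _)).trans_lt
      (ENNReal.add_lt_top.2 ⟨(hA 0).volume_lt_top, h0.trans_lt hsum.lt_top⟩)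

/-! ### Contraction and convergence of the scheme -/

theorem symmDist_shift_le {F : ℤ → Set (Space n)} {D : ℝ≥0∞}
    (hD : ∀ i, symmDist (F i) (F (i + 1)) ≤ D) (i : ℤ) (s : ℕ) :
    symmDist (F (i - s)) (F i) ≤ s * D := by
  induction s with
  | zero => simp [symmDist_self]
  | succ s ih =>
    refine (symmDist_triangle _ (F (i - s)) _).trans ?_
    have h := hD (i - (s + 1 : ℕ))
    rw [show i - ((s + 1 : ℕ) : ℤ) + 1 = i - s by push_cast; ring] at h
    refine (add_le_add h ih).trans_eq ?_
    push_cast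
    ring

/-- The set of level `k` at the left end of the dyadic interval that contains `y`. -/
def nodeSet (c : Choices n) (m : ℕ) (F : ℤ → Set (Space n)) (k : ℕ) (y : ℝ) : Set (Space n) :=
  levelSets c m F k ⌊y * 2 ^ k⌋

/-- Makes the refinement estimate, which compares index `i` with `i / 2`, applicable over a fixed
point `y`. -/
theorem floor_mul_two_pow_succ_ediv_two (y : ℝ) (k : ℕ) :
    ⌊y * 2 ^ (k + 1)⌋ / 2 = ⌊y * 2 ^ k⌋ := by
  have h1 : 2 * ⌊y * 2 ^ k⌋ ≤ ⌊y * 2 ^ (k + 1)⌋ := by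
    rw [Int.le_floor]
    push_cast
    rw [pow_succ]
    linarith [Int.floor_le (y * 2 ^ k)]
  have h2 : ⌊y * 2 ^ (k + 1)⌋ < 2 * ⌊y * 2 ^ k⌋ + 2 := by
    rw [Int.floor_lt]
    push_cast
    rw [pow_succ]
    linarith [Int.lt_floor_add_one (y * 2 ^ k)]
  omega

theorem half_mem_Icc : (1 / 2 : ℝ) ∈ Icc (0 : ℝ) 1 := by constructor <;> norm_num

section Scheme

variable [Nontrivial (Space n)] (c : Choices n) {F : ℤ → Set (Space n)} {D : ℝ≥0∞}

theorem symmDist_halfAverage_left {A B : Set (Space n)} (hA : IsRegularJordan A)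
    (hB : IsRegularJordan B) :
    symmDist (measureAverage c (1 / 2) A B) A ≤ 2⁻¹ * symmDist A B := by
  have := symmDist_measureAverage_left c hA hB half_mem_Icc
  rwa [show (1 - 1 / 2 : ℝ) = 2⁻¹ by norm_num, ENNReal.ofReal_inv_of_pos two_pos,
    ENNReal.ofReal_ofNat] at this

theorem symmDist_halfAverage_right {A B : Set (Space n)} (hA : IsRegularJordan A)
    (hB : IsRegularJordan B) :
    symmDist (measureAverage c (1 / 2) A B) B ≤ 2⁻¹ * symmDist A B := by
  have := symmDist_measureAverage_right c hA hB half_mem_Icc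
  rwa [one_div, ENNReal.ofReal_inv_of_pos two_pos, ENNReal.ofReal_ofNat, ← one_div] at this

theorem isRegularJordan_doubleStep (hF : ∀ i, IsRegularJordan (F i)) (i : ℤ) :
    IsRegularJordan (doubleStep c F i) := by
  unfold doubleStep
  split_ifs
  · exact hF _
  · exact isRegularJordan_measureAverage c (hF _) (hF _) half_mem_Icc

theorem symmDist_doubleStep_succ (hF : ∀ i, IsRegularJordan (F i))
    (hD : ∀ i, symmDist (F i) (F (i + 1)) ≤ D) (i : ℤ) :
    symmDist (doubleStep c F i) (doubleStep c F (i + 1)) ≤ 2⁻¹ * D := by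
  unfold doubleStep
  rcases Int.emod_two_eq_zero_or_one i with h | h
  · rw [if_pos h, if_neg (by omega), show (i + 1) / 2 = i / 2 by omega, symmDist_comm]
    exact (symmDist_halfAverage_left c (hF _) (hF _)).trans (by gcongr; exact hD _)
  · rw [if_neg (by omega), if_pos (by omega), show (i + 1) / 2 = i / 2 + 1 by omega]
    exact (symmDist_halfAverage_right c (hF _) (hF _)).trans (by gcongr; exact hD _)

theorem symmDist_doubleStep_le (hF : ∀ i, IsRegularJordan (F i))
    (hD : ∀ i, symmDist (F i) (F (i + 1)) ≤ D) (i : ℤ) :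
    symmDist (doubleStep c F i) (F (i / 2)) ≤ 2⁻¹ * D := by
  unfold doubleStep
  split_ifs with h
  · simp [symmDist_self]
  · exact (symmDist_halfAverage_left c (hF _) (hF _)).trans (by gcongr; exact hD _)

theorem isRegularJordan_averageStep_iterate (hF : ∀ i, IsRegularJordan (F i)) (j : ℕ) (i : ℤ) :
    IsRegularJordan ((averageStep c)^[j] F i) := by
  induction j generalizing i with
  | zero => exact hF i
  | succ j ih =>
    rw [Function.iterate_succ_apply']
    exact isRegularJordan_measureAverage c (ih _) (ih _) half_mem_Icc

/-- Neighbouring averages share the set of index `i + 1`, and each is within `D / 2` of it. -/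
theorem symmDist_averageStep_iterate_succ (hF : ∀ i, IsRegularJordan (F i))
    (hD : ∀ i, symmDist (F i) (F (i + 1)) ≤ D) (j : ℕ) (i : ℤ) :
    symmDist ((averageStep c)^[j] F i) ((averageStep c)^[j] F (i + 1)) ≤ D := by
  induction j generalizing i with
  | zero => exact hD i
  | succ j ih =>
    have hreg := isRegularJordan_averageStep_iterate c hF j
    rw [Function.iterate_succ_apply']
    refine (symmDist_triangle _ ((averageStep c)^[j] F (i + 1)) _).trans ?_
    refine (add_le_add
      ((symmDist_halfAverage_right c (hreg _) (hreg _)).trans (mul_le_mul_right (ih i) _))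
      ((symmDist_comm _ _).trans_le ((symmDist_halfAverage_left c (hreg _) (hreg _)).trans
        (mul_le_mul_right (ih (i + 1)) _)))).trans ?_
    rw [← add_mul, ENNReal.inv_two_add_inv_two, one_mul]

theorem symmDist_averageStep_iterate_le (hF : ∀ i, IsRegularJordan (F i))
    (hD : ∀ i, symmDist (F i) (F (i + 1)) ≤ D) (j : ℕ) (i : ℤ) :
    symmDist ((averageStep c)^[j] F i) (F i) ≤ j * D := by
  induction j with
  | zero => simp [symmDist_self]
  | succ j ih =>
    have hreg := isRegularJordan_averageStep_iterate c hF j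
    refine (symmDist_triangle _ ((averageStep c)^[j] F i) _).trans ?_
    rw [Nat.cast_succ, add_mul, one_mul, add_comm, Function.iterate_succ_apply']
    refine add_le_add ih ((symmDist_halfAverage_left c (hreg _) (hreg _)).trans ?_)
    refine (mul_le_of_le_one_left' ?_).trans (symmDist_averageStep_iterate_succ c hF hD j i)
    exact ENNReal.inv_le_one.2 one_le_two

variable (m : ℕ)

theorem isRegularJordan_refine (hF : ∀ i, IsRegularJordan (F i)) (i : ℤ) :
    IsRegularJordan (refine c m F i) :=
  isRegularJordan_averageStep_iterate c (isRegularJordan_doubleStep c hF) _ _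

theorem symmDist_refine_succ (hF : ∀ i, IsRegularJordan (F i))
    (hD : ∀ i, symmDist (F i) (F (i + 1)) ≤ D) (i : ℤ) :
    symmDist (refine c m F i) (refine c m F (i + 1)) ≤ 2⁻¹ * D := by
  have := symmDist_averageStep_iterate_succ c (isRegularJordan_doubleStep c hF)
    (symmDist_doubleStep_succ c hF hD) (m - 1) (i - (((m - 1) / 2 : ℕ) : ℤ))
  rwa [sub_add_eq_add_sub] at this

theorem symmDist_refine_le (hm : 1 ≤ m) (hF : ∀ i, IsRegularJordan (F i))
    (hD : ∀ i, symmDist (F i) (F (i + 1)) ≤ D) (i : ℤ) :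
    symmDist (refine c m F i) (F (i / 2)) ≤ 2 * m * D := by
  have hF' := isRegularJordan_doubleStep c hF
  have hD' := symmDist_doubleStep_succ c hF hD
  set s := (m - 1) / 2 with hs
  have h1 := symmDist_averageStep_iterate_le c hF' hD' (m - 1) (i - s)
  have h2 := symmDist_shift_le hD' i s
  have h3 := symmDist_doubleStep_le c hF hD i
  refine (symmDist_triangle _ (doubleStep c F (i - s)) _).trans
    ((add_le_add h1 ((symmDist_triangle _ (doubleStep c F i) _).trans (add_le_add h2 h3))).trans ?_)
  -- Moves of size at most `D / 2`: `m - 1` from averaging, `s` from the index shift, one from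
  -- doubling.
  have hle : ((m - 1 : ℕ) : ℝ≥0∞) + (s + 1) ≤ 2 * m := by
    exact_mod_cast (by omega : m - 1 + (s + 1) ≤ 2 * m)
  calc ((m - 1 : ℕ) : ℝ≥0∞) * (2⁻¹ * D) + (s * (2⁻¹ * D) + 2⁻¹ * D)
      = (((m - 1 : ℕ) : ℝ≥0∞) + (s + 1)) * (2⁻¹ * D) := by ring
    _ ≤ (2 * m) * D := by
        gcongr
        exact mul_le_of_le_one_left' (ENNReal.inv_le_one.2 one_le_two)

theorem isRegularJordan_levelSets (hF : ∀ i, IsRegularJordan (F i)) (k : ℕ) (i : ℤ) :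
    IsRegularJordan (levelSets c m F k i) := by
  unfold levelSets
  induction k generalizing i with
  | zero => exact hF i
  | succ k ih =>
    rw [Function.iterate_succ_apply']
    exact isRegularJordan_refine c m ih i

theorem symmDist_levelSets_succ (hF : ∀ i, IsRegularJordan (F i))
    (hD : ∀ i, symmDist (F i) (F (i + 1)) ≤ D) (k : ℕ) (i : ℤ) :
    symmDist (levelSets c m F k i) (levelSets c m F k (i + 1)) ≤ 2⁻¹ ^ k * D := by
  induction k generalizing i with
  | zero => simpa [levelSets] using hD i
  | succ k ih =>
    have := symmDist_refine_succ c m (isRegularJordan_levelSets c m hF k) ih i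
    rw [pow_succ', mul_assoc]
    rwa [levelSets, Function.iterate_succ_apply']

theorem symmDist_nodeSet_succ (hm : 1 ≤ m) (hF : ∀ i, IsRegularJordan (F i))
    (hD : ∀ i, symmDist (F i) (F (i + 1)) ≤ D) (k : ℕ) (y : ℝ) :
    symmDist (nodeSet c m F k y) (nodeSet c m F (k + 1) y) ≤ 2⁻¹ ^ k * (2 * m * D) := by
  have := symmDist_refine_le c m hm (isRegularJordan_levelSets c m hF k)
    (symmDist_levelSets_succ c m hF hD k) ⌊y * 2 ^ (k + 1)⌋
  rw [floor_mul_two_pow_succ_ediv_two, symmDist_comm] at this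
  rw [nodeSet, nodeSet, levelSets, levelSets, Function.iterate_succ_apply']
  refine this.trans_eq ?_
  ring

theorem symmDist_interpolant_le (hF : ∀ i, IsRegularJordan (F i))
    (hD : ∀ i, symmDist (F i) (F (i + 1)) ≤ D) (k : ℕ) (y : ℝ) :
    symmDist (interpolant c m F k y) (nodeSet c m F k y) ≤ 2⁻¹ ^ k * D := by
  have h1 := Int.floor_le (y * 2 ^ k)
  have h2 := Int.lt_floor_add_one (y * 2 ^ k)
  have hreg := isRegularJordan_levelSets c m hF k
  refine (symmDist_measureAverage_left c (hreg _) (hreg _) ⟨?_, ?_⟩).trans ?_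
  · linarith
  · linarith
  · refine (mul_le_of_le_one_left' ?_).trans (symmDist_levelSets_succ c m hF hD k _)
    rw [ENNReal.ofReal_le_one]
    linarith

/-- The tail of the displacements `2^{-j} · 2 m D` from level `k` on sums to `2^{-k} · 4 m D`. -/
theorem exists_nodeSet_limit (hm : 1 ≤ m) (hF : ∀ i, IsRegularJordan (F i))
    (hD : ∀ i, symmDist (F i) (F (i + 1)) ≤ D) (hfin : D ≠ ∞) (y : ℝ) :
    ∃ S, IsFiniteLebesgue S ∧ ∀ k, symmDist (nodeSet c m F k y) S ≤ 2⁻¹ ^ k * (4 * m * D) := by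
  have hgeom : ∀ k, ∑' j, (2⁻¹ : ℝ≥0∞) ^ (k + j) * (2 * m * D) = 2⁻¹ ^ k * (4 * m * D) := by
    intro k
    simp_rw [ENNReal.tsum_mul_right, pow_add, ENNReal.tsum_mul_left, ENNReal.tsum_geometric,
      ENNReal.one_sub_inv_two, inv_inv]
    ring
  obtain ⟨S, hS, hle⟩ := exists_symmDist_le_tsum
    (fun k => (isRegularJordan_levelSets c m hF k ⌊y * 2 ^ k⌋).isFiniteLebesgue)
    (fun k => symmDist_nodeSet_succ c m hm hF hD k y) (by
      have := hgeom 0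
      simp only [zero_add] at this
      rw [this]
      finiteness)
  exact ⟨S, hS, fun k => (hle k).trans_eq (hgeom k)⟩

theorem exists_interpolant_limit (hm : 1 ≤ m) (hF : ∀ i, IsRegularJordan (F i))
    (hD : ∀ i, symmDist (F i) (F (i + 1)) ≤ D) (hfin : D ≠ ∞) :
    ∃ Flim : ℝ → Set (Space n), (∀ y, IsFiniteLebesgue (Flim y)) ∧
      (∀ y, symmDist (F ⌊y⌋) (Flim y) ≤ 4 * m * D) ∧
      ∀ k y, symmDist (interpolant c m F k y) (Flim y) ≤ 2⁻¹ ^ k * ((4 * m + 1) * D) := by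
  choose S hS hle using exists_nodeSet_limit c m hm hF hD hfin
  refine ⟨S, hS, fun y => ?_, fun k y => ?_⟩
  · simpa [nodeSet, levelSets] using hle y 0
  · refine (symmDist_triangle _ (nodeSet c m F k y) _).trans
      ((add_le_add (symmDist_interpolant_le c m hF hD k y) (hle y k)).trans_eq ?_)
    ring

end Scheme

/-! ### Uniform limits and the approximation theorem -/

theorem IsUniformLimit.of_geometric {Φ : ℕ → ℝ → Set (Space n)} {Φlim : ℝ → Set (Space n)}
    {D : ℝ≥0∞} (hfin : D ≠ ∞) (hΦ : ∀ y, IsFiniteLebesgue (Φlim y))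
    (h : ∀ k y, symmDist (Φ k y) (Φlim y) ≤ 2⁻¹ ^ k * D) : IsUniformLimit Φ Φlim := by
  refine ⟨hΦ, tendsto_of_tendsto_of_tendsto_of_le_of_le tendsto_const_nhds ?_
    (fun _ => bot_le) (fun k => iSup_le (h k))⟩
  have h1 : Tendsto (fun k : ℕ => (2⁻¹ : ℝ≥0∞) ^ k) atTop (𝓝 0) :=
    ENNReal.tendsto_pow_atTop_nhds_zero_of_lt_one (ENNReal.inv_lt_one.2 ENNReal.one_lt_two)
  simpa using ENNReal.Tendsto.mul_const h1 (Or.inr hfin)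

/-- Limits are unique only up to null sets, so the estimate is transferred to an arbitrary one
through the triangle inequality. -/
theorem IsUniformLimit.symmDist_le {Φ : ℕ → ℝ → Set (Space n)} {Φlim : ℝ → Set (Space n)}
    (h : IsUniformLimit Φ Φlim) {A : Set (Space n)} {y : ℝ} {b : ℝ≥0∞}
    (hb : ∀ k, symmDist A (Φ k y) ≤ b) : symmDist (Φlim y) A ≤ b := by
  have h1 : Tendsto (fun k => (⨆ x : ℝ, symmDist (Φ k x) (Φlim x)) + b) atTop (𝓝 (0 + b)) :=
    h.2.add tendsto_const_nhds
  rw [zero_add] at h1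
  refine ge_of_tendsto' h1 fun k => ?_
  refine (symmDist_triangle _ (Φ k y) _).trans (add_le_add ?_ ?_)
  · rw [symmDist_comm]
    exact le_iSup (fun x => symmDist (Φ k x) (Φlim x)) y
  · rw [symmDist_comm]
    exact hb k

end SetSpline

end

/-- The interpolant `F_k` has its nodes at `i 2^{-k}`, so the function that belongs to samples taken at
`δ + i h` is `x ↦ F_k((x - δ) / h)`, and likewise for the limit. The number `C` depends only on the
degree `m`. -/
theorem theorem5p2 (m : ℕ) (hm : 1 ≤ m) :
    ∃ C : ℝ, 0 < C ∧
      ∀ (n : ℕ), 1 ≤ n → ∀ (c : SetSpline.Choices n)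
        (G : ℝ → Set (SetSpline.Space n)) (L h δ : ℝ),
        (∀ x, SetSpline.IsFiniteLebesgue (G x)) →
        0 ≤ L →
        (∀ x y, SetSpline.symmDist (G x) (G y) ≤ ENNReal.ofReal (L * |x - y|)) →
        0 < h → 0 ≤ δ → δ < h →
        (∀ i : ℤ, SetSpline.IsRegularJordan (G (δ + i * h))) →
        (∀ (k : ℕ) (x : ℝ),
          SetSpline.symmDist (G x)
            (SetSpline.interpolant c m (fun i : ℤ => G (δ + i * h)) k ((x - δ) / h))
            ≤ ENNReal.ofReal (C * L * h)) ∧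
        (∃ Flim : ℝ → Set (SetSpline.Space n),
          SetSpline.IsUniformLimit
            (SetSpline.interpolant c m (fun i : ℤ => G (δ + i * h))) Flim) ∧
        (∀ Flim : ℝ → Set (SetSpline.Space n),
          SetSpline.IsUniformLimit
            (SetSpline.interpolant c m (fun i : ℤ => G (δ + i * h))) Flim →
          ∀ x : ℝ, SetSpline.symmDist (Flim ((x - δ) / h)) (G x)
            ≤ ENNReal.ofReal (C * L * h)) := by
  -- In units of `L h`: `1` from `G x` to the sample at the left node, `4 m` from there to the
  -- limit, `4 m + 1` from the limit back to `F_k`.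
  refine ⟨8 * m + 2, by positivity, ?_⟩
  intro n hn c G L h δ _ hL hG hh _ _ hreg
  have : Nonempty (Fin n) := ⟨⟨0, hn⟩⟩
  have : Nontrivial (SetSpline.Space n) := inferInstance
  have hD : ∀ i : ℤ, SetSpline.symmDist (G (δ + i * h)) (G (δ + (i + 1 : ℤ) * h)) ≤
      ENNReal.ofReal (L * h) := by
    intro i
    refine (hG _ _).trans_eq ?_
    rw [show δ + i * h - (δ + (i + 1 : ℤ) * h) = -h by push_cast; ring, abs_neg, abs_of_pos hh]
  obtain ⟨Flim, hfin, hnode, hlim⟩ := SetSpline.exists_interpolant_limit c m hm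
    (F := fun i : ℤ => G (δ + i * h)) hreg hD ENNReal.ofReal_ne_top
  have hbound : ∀ (k : ℕ) (x : ℝ), SetSpline.symmDist (G x)
      (SetSpline.interpolant c m (fun i : ℤ => G (δ + i * h)) k ((x - δ) / h)) ≤
      ENNReal.ofReal ((8 * m + 2) * L * h) := by
    intro k x
    set y := (x - δ) / h with hy
    have hx : x = δ + y * h := by
      rw [hy]
      field_simp
      ring
    have h1 : SetSpline.symmDist (G x) (G (δ + ⌊y⌋ * h)) ≤ ENNReal.ofReal (L * h) := by
      refine (hG _ _).trans (ENNReal.ofReal_le_ofReal (mul_le_mul_of_nonneg_left ?_ hL))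
      have e1 := Int.floor_le y
      have e2 := (Int.lt_floor_add_one y).le
      rw [hx, show δ + y * h - (δ + ⌊y⌋ * h) = (y - ⌊y⌋) * h by ring,
        abs_of_nonneg (mul_nonneg (by linarith) hh.le)]
      exact mul_le_of_le_one_left hh.le (by linarith)
    have h2 := hlim k y
    rw [SetSpline.symmDist_comm] at h2
    have h3 : (2⁻¹ : ENNReal) ^ k ≤ 1 := pow_le_one' (ENNReal.inv_le_one.2 one_le_two) k
    have h4 : ENNReal.ofReal ((8 * m + 2) * L * h) = (8 * m + 2) * ENNReal.ofReal (L * h) := by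
      rw [mul_assoc, ENNReal.ofReal_mul (by positivity), ENNReal.ofReal_add (by positivity)
        zero_le_two, ENNReal.ofReal_mul (by positivity)]
      simp
    rw [h4]
    refine (SetSpline.symmDist_triangle _ _ _).trans ((add_le_add h1
      ((SetSpline.symmDist_triangle _ _ _).trans (add_le_add (hnode y)
        (h2.trans (mul_le_of_le_one_left' h3))))).trans_eq ?_)
    ring
  exact ⟨hbound, ⟨Flim, SetSpline.IsUniformLimit.of_geometric
    (ENNReal.mul_ne_top (by finiteness) ENNReal.ofReal_ne_top) hfin hlim⟩,
    fun Flim' hFlim' x => hFlim'.symmDist_le fun k => hbound k x⟩
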